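/- Let $\mathscr C$ be the small category whose objects are the (possibly empty) bounded open intervals $V$ of the half-line $[0,\infty)$, including those of the form $[0,a)$, with $\mathrm{Hom}(U,V)=\{n\in\mathbb N^\times : nU\subset V\}$ for $U\neq\emptyset$ (composition being the product of integers) and with exactly one morphism $\emptyset\to V$. Let $J$ be the Grothendieck topology on $\mathscr C$ generated by the ordinary open covers. The topos $[0,\infty)\rtimes\mathbb N^\times$ is the category of sheaves of sets on $(\mathscr C,J)$. To a point $p$ of this topos (a geometric morphism from the topos of sets) one associates the functor $F_p(V)=p^*(\mathbf{a}yV)$, $\mathscr C\to\mathrm{Sets}$, where $\mathbf{a}yV$ is the sheaf represented by $V$. The support of $p$ is the set of all $\lambda\in[0,\infty)$ for which there are an object $V\ni\lambda$ and $x\in F_p(V)$ such that $x$ is in the image of $F_p(U)\to F_p(V)$ for every object $U\subset V$ containing $\lambda$. Let $\mathbb R_{\max}=(\mathbb R\cup\{-\infty\},\max,+)$ (isomorphic to $\mathbb R_+^{\max}$ by the exponential), and likewise $\mathbb Z_{\max}$ and, for an ordered abelian group $H$, $H_{\max}$. The arithmetic site is the topos of sets with an action of the multiplicative monoid $\mathbb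 N^\times$, with structure sheaf $\mathbb Z_{\max}$, on which $n$ acts by $\mathrm{Fr}_n(x)=x^n$ (that is, $k\mapsto nk$). A point of it over $\mathbb R_{\max}$ is a pair of a point of the topos and a local morphism of semirings from the stalk of the structure sheaf to $\mathbb R_{\max}$; $\mathscr A(\mathbb R_+^{\max})$ is the set of isomorphism classes of such points. An abelian group $H$ has rank one if $\dim_{\mathbb Q}(H\otimes\mathbb Q)=1$. A point of the arithmetic site over $\mathbb R_{\max}$ corresponds to the rank one subgroup $H\subset\mathbb R$ if the image of the stalk in $\mathbb R_{\max}$ is $H\cup\{-\infty\}$; it corresponds to the abstract rank one totally ordered group $H$ if the $\mathbb N^\times$-set associated with the underlying point of the topos is isomorphic to $\{h\in H: h>0\}$ and the morphism to $\mathbb R_{\max}$ takes only the values $-\infty$ and $0$. **Theorem.** (i) There is a canonical bijection $\Theta$ from $\mathscr A(\mathbb R_+^{\max})$ to the set of isomorphism classes of points of $[0,\infty)\rtimes\mathbb N^\times$. It is such that, for every rank one subgroup $H\subset\mathbb R$, a class in $\mathscr A(\mathbb R_+^{\max})$ corresponds to $H$ if and only if its image by $\Theta$ is the class of a point $\mathfrak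 p_H$ with functor isomorphic to $F_H(V)=V\cap H\cap(0,\infty)$; and, for every abstract rank one totally ordered group $H$, a class corresponds to $H$ if and only if its image is the class of a point $\mathfrak q_H$ with functor isomorphic to $F'_H$, where $F'_H(V)=\{h\in H: h>0\}$ if $0\in V$, $F'_H(V)=\emptyset$ if $0\notin V$, and $n$ acts by multiplication. (ii) There is a canonical bijection from $\mathbb Q^\times\backslash\mathbb A_{\mathbb Q}/\hat{\mathbb Z}^*$ to $\mathscr A(\mathbb R_+^{\max})$. With $H_a=\{q\in\mathbb Q: q\,a_f\in\hat{\mathbb Z}\}$ for an adele $a=(a_\infty,a_f)$, it sends the class of $a$ to the element corresponding to the subgroup $|a_\infty|H_a\subset\mathbb R$ if $a_\infty\neq0$, and to the element corresponding to the ordered group $H_a$ if $a_\infty=0$. (iii) For every point of $[0,\infty)\rtimes\mathbb N^\times$, either $0$ is not in the support or the support is $\{0\}$. The points with $0$ not in the support are, up to isomorphism, exactly the $\mathfrak p_H$ for $H\subset\mathbb R$ a rank one subgroup; $\mathfrak p_H$ exists for every such $H$, and $\mathfrak p_H\simeq\mathfrak p_{H'}$ if and only if $H=H'$. The points with support $\{0\}$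 are, up to isomorphism, exactly the $\mathfrak q_H$ for $H$ an abstract rank one totally ordered group; $\mathfrak q_H$ exists for every such $H$, and $\mathfrak q_H\simeq\mathfrak q_{H'}$ if and only if $H$ and $H'$ are isomorphic as ordered groups. -/

import Mathlib

open CategoryTheory
open scoped NNReal

noncomputable section

namespace ScalingTopos

/-! ### Points of a topos -/

/-- A point of a topos `E`: a geometric morphism from the topos of sets to `E`, given by its inverse
image functor, which preserves finite limits, and its direct image functor, right adjoint to it. -/
structure ToposPoint (E : Type*) [Category E] where
  inverse : E ⥤ Type
  direct : Type ⥤ E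
  adj : inverse ⊣ direct
  exact : Limits.PreservesFiniteLimits inverse

attribute [instance] ToposPoint.exact

/-- Two points are isomorphic when their inverse image functors are. -/
instance ToposPoint.setoid (E : Type*) [Category E] : Setoid (ToposPoint E) where
  r p q := Nonempty (p.inverse ≅ q.inverse)
  iseqv :=
    { refl := fun _ => ⟨Iso.refl _⟩
      symm := fun ⟨e⟩ => ⟨e.symm⟩
      trans := fun ⟨e⟩ ⟨f⟩ => ⟨e.trans f⟩ }

/-- The set of isomorphism classes of points of `E`. -/
abbrev ToposPoint.IsoClass (E : Type*) [Category E] := Quotient (ToposPoint.setoid E)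

/-! ### The max-plus construction -/

/-- The semifield `H_max = H ∪ {-∞}` of a totally ordered abelian group `H`: its sum is the maximum,
its product is the addition of `H`. -/
def MaxPlus (H : Type*) := WithBot H

namespace MaxPlus

/-- The inclusion of `H` in `H_max`. -/
def of {H : Type*} (h : H) : MaxPlus H := (h : WithBot H)

instance {H : Type*} [LinearOrder H] : LinearOrder (MaxPlus H) :=
  inferInstanceAs (LinearOrder (WithBot H))

variable {H : Type*} [AddCommGroup H] [LinearOrder H] [IsOrderedAddMonoid H]

instance : Add (MaxPlus H) := ⟨fun a b => max a b⟩

instance : Zero (MaxPlus H) := ⟨(⊥ : WithBot H)⟩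

instance : Mul (MaxPlus H) := ⟨(fun a b => a + b : WithBot H → WithBot H → WithBot H)⟩

instance : One (MaxPlus H) := ⟨of 0⟩

instance : CommSemiring (MaxPlus H) where
  add_assoc := max_assoc
  add_comm := max_comm
  zero_add a := max_eq_right (bot_le (α := WithBot H) (a := a))
  add_zero a := max_eq_left (bot_le (α := WithBot H) (a := a))
  nsmul := nsmulRec
  mul_assoc := add_assoc (G := WithBot H)
  mul_comm := add_comm (G := WithBot H)
  one_mul := zero_add (M := WithBot H)
  mul_one := add_zero (M := WithBot H)
  zero_mul := WithBot.bot_add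
  mul_zero := WithBot.add_bot
  left_distrib a b c := (max_add_add_left (α := WithBot H) a b c).symm
  right_distrib a b c := (max_add_add_right (α := WithBot H) a b c).symm

theorem mul_le_mul_max {a b c d : MaxPlus H} (h : a ≤ b) (h' : c ≤ d) : a * c ≤ b * d := by
  have := add_le_add (α := WithBot H) h h'
  exact this

theorem pow_mono (n : ℕ) : Monotone fun a : MaxPlus H => a ^ n := by
  intro a b h
  induction n with
  | zero => simp
  | succ n ih => simpa only [pow_succ] using mul_le_mul_max ih h

/-- The Frobenius endomorphism `Fr_n : x ↦ x ^ n` of `H_max`, which is `h ↦ n h` on `H`. -/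
def frobenius (n : ℕ+) : MaxPlus H →+* MaxPlus H where
  toFun x := x ^ (n : ℕ)
  map_one' := one_pow _
  map_mul' a b := mul_pow a b _
  map_zero' := zero_pow n.pos.ne'
  map_add' _ _ := (pow_mono (H := H) n).map_max

end MaxPlus

/-! ### Stalks of presheaves of semirings

If `O` is a presheaf of semirings on `C` and `p` is a point of the topos of presheaves of sets on
`C`, the set `p^* O` is a semiring, because `p^*` preserves finite products: the sum is the map
`p^* O × p^* O ≅ p^* (O × O) → p^* O`, and similarly for the other operations. -/

section Stalk

variable {C : Type} [SmallCategory C]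

section General

variable (G : (Cᵒᵖ ⥤ Type) ⥤ Type) [Limits.PreservesFiniteLimits G]

theorem existsUnique_pair {X Y : Cᵒᵖ ⥤ Type} (x : G.obj X) (y : G.obj Y) :
    ∃! t : G.obj (FunctorToTypes.prod X Y),
      G.map FunctorToTypes.prod.fst t = x ∧ G.map FunctorToTypes.prod.snd t = y := by
  have h := Limits.mapIsLimitOfPreservesOfIsLimit G _ _ (FunctorToTypes.binaryProductLimit X Y)
  obtain ⟨l, h1, h2⟩ := Limits.BinaryFan.IsLimit.lift' h
    (TypeCat.ofHom fun _ : PUnit => x) (TypeCat.ofHom fun _ : PUnit => y)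
  refine ⟨l PUnit.unit, ⟨ConcreteCategory.congr_hom h1 _, ConcreteCategory.congr_hom h2 _⟩, ?_⟩
  rintro t ⟨rfl, rfl⟩
  have : TypeCat.ofHom (fun _ : PUnit => t) = l := by
    apply Limits.BinaryFan.IsLimit.hom_ext h
    · rw [h1]; rfl
    · rw [h2]; rfl
  rw [← this]
  rfl

/-- The element of `G (X × Y)` with given components in `G X` and `G Y`. -/
def pair {X Y : Cᵒᵖ ⥤ Type} (x : G.obj X) (y : G.obj Y) : G.obj (FunctorToTypes.prod X Y) :=
  (existsUnique_pair G x y).choose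

theorem pair_map {T X Y : Cᵒᵖ ⥤ Type} (f : T ⟶ X) (g : T ⟶ Y) (t : G.obj T) :
    pair G (G.map f t) (G.map g t) = G.map (FunctorToTypes.prod.lift f g) t := by
  refine ((existsUnique_pair G (G.map f t) (G.map g t)).choose_spec.2 _ ⟨?_, ?_⟩).symm
  · rw [← Functor.map_comp_apply]; rfl
  · rw [← Functor.map_comp_apply]; rfl

/-- The terminal presheaf. -/
def point : Cᵒᵖ ⥤ Type := (Functor.const _).obj PUnit

/-- The map to the terminal presheaf. -/
def toPoint (T : Cᵒᵖ ⥤ Type) : T ⟶ point where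
  app _ := TypeCat.ofHom fun _ => PUnit.unit

theorem existsUnique_point : ∃! _t : G.obj (point (C := C)), True := by
  have h : Limits.IsTerminal (point (C := C)) :=
    Limits.IsTerminal.ofUniqueHom toPoint (fun _ _ => rfl)
  have h' := Limits.IsTerminal.isTerminalObj G _ h
  refine ⟨h'.from PUnit PUnit.unit, trivial, fun t _ => ?_⟩
  exact ConcreteCategory.congr_hom
    (h'.hom_ext (TypeCat.ofHom fun _ : PUnit => t) (h'.from PUnit)) PUnit.unit

/-- The unique element of `G 1`. -/
def pt : G.obj (point (C := C)) := (existsUnique_point G).choose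

theorem map_toPoint {T : Cᵒᵖ ⥤ Type} (t : G.obj T) : G.map (toPoint T) t = pt G :=
  (existsUnique_point G).choose_spec.2 _ trivial

theorem exists_triple {X : Cᵒᵖ ⥤ Type} (x y z : G.obj X) :
    ∃ (T : Cᵒᵖ ⥤ Type) (f g h : T ⟶ X) (t : G.obj T),
      G.map f t = x ∧ G.map g t = y ∧ G.map h t = z := by
  obtain ⟨s, ⟨hs, hs'⟩, -⟩ := existsUnique_pair G y z
  obtain ⟨t, ⟨ht, ht'⟩, -⟩ := existsUnique_pair G x s
  refine ⟨_, FunctorToTypes.prod.fst, FunctorToTypes.prod.snd ≫ FunctorToTypes.prod.fst,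
    FunctorToTypes.prod.snd ≫ FunctorToTypes.prod.snd, t, ht, ?_, ?_⟩
  · rw [Functor.map_comp_apply, ht', hs]
  · rw [Functor.map_comp_apply, ht', hs']

end General

variable (O : Cᵒᵖ ⥤ CommSemiRingCat.{0})

/-- The presheaf of sets underlying a presheaf of semirings. -/
abbrev underlying : Cᵒᵖ ⥤ Type := O ⋙ forget CommSemiRingCat

/-- The sum `O × O → O`. -/
def addMap : FunctorToTypes.prod (underlying O) (underlying O) ⟶ underlying O where
  app c := TypeCat.ofHom fun z => ((z.1 : O.obj c) + (z.2 : O.obj c) : O.obj c)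
  naturality _ _ u := by
    ext z
    exact ((O.map u).hom.map_add z.1 z.2).symm

/-- The product `O × O → O`. -/
def mulMap : FunctorToTypes.prod (underlying O) (underlying O) ⟶ underlying O where
  app c := TypeCat.ofHom fun z => ((z.1 : O.obj c) * (z.2 : O.obj c) : O.obj c)
  naturality _ _ u := by
    ext z
    exact ((O.map u).hom.map_mul z.1 z.2).symm

/-- The zero section `1 → O`. -/
def zeroMap : point ⟶ underlying O where
  app c := TypeCat.ofHom fun _ => (0 : O.obj c)
  naturality _ _ u := by
    ext z
    exact (O.map u).hom.map_zero.symm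

/-- The unit section `1 → O`. -/
def oneMap : point ⟶ underlying O where
  app c := TypeCat.ofHom fun _ => (1 : O.obj c)
  naturality _ _ u := by
    ext z
    exact (O.map u).hom.map_one.symm

/-- The stalk `p^* O` of a presheaf of semirings `O` at a point `p` of the presheaf topos. -/
def Stalk (p : ToposPoint (Cᵒᵖ ⥤ Type)) : Type := p.inverse.obj (underlying O)

namespace Stalk

variable (p : ToposPoint (Cᵒᵖ ⥤ Type))

instance : Add (Stalk O p) := ⟨fun x y => p.inverse.map (addMap O) (pair p.inverse x y)⟩

instance : Mul (Stalk O p) := ⟨fun x y => p.inverse.map (mulMap O) (pair p.inverse x y)⟩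

instance : Zero (Stalk O p) := ⟨p.inverse.map (zeroMap O) (pt p.inverse)⟩

instance : One (Stalk O p) := ⟨p.inverse.map (oneMap O) (pt p.inverse)⟩

variable {O p}

/-- The element of the stalk given by a map `f : T ⟶ O` and an element of `p^* T`. -/
def mk {T : Cᵒᵖ ⥤ Type} (f : T ⟶ underlying O) (t : p.inverse.obj T) : Stalk O p :=
  p.inverse.map f t

variable {T : Cᵒᵖ ⥤ Type} (t : p.inverse.obj T)

theorem add_mk (f g : T ⟶ underlying O) :
    mk f t + mk g t = mk (FunctorToTypes.prod.lift f g ≫ addMap O) t := by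
  show p.inverse.map (addMap O) (pair p.inverse (p.inverse.map f t) (p.inverse.map g t)) = _
  rw [pair_map, ← Functor.map_comp_apply]
  rfl

theorem mul_mk (f g : T ⟶ underlying O) :
    mk f t * mk g t = mk (FunctorToTypes.prod.lift f g ≫ mulMap O) t := by
  show p.inverse.map (mulMap O) (pair p.inverse (p.inverse.map f t) (p.inverse.map g t)) = _
  rw [pair_map, ← Functor.map_comp_apply]
  rfl

theorem zero_mk : (0 : Stalk O p) = mk (toPoint T ≫ zeroMap O) t := by
  show p.inverse.map (zeroMap O) (pt p.inverse) = p.inverse.map (toPoint T ≫ zeroMap O) t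
  rw [Functor.map_comp_apply, map_toPoint]

theorem one_mk : (1 : Stalk O p) = mk (toPoint T ≫ oneMap O) t := by
  show p.inverse.map (oneMap O) (pt p.inverse) = p.inverse.map (toPoint T ≫ oneMap O) t
  rw [Functor.map_comp_apply, map_toPoint]

theorem exists_mk (x y z : Stalk O p) :
    ∃ (T : Cᵒᵖ ⥤ Type) (f g h : T ⟶ underlying O) (t : p.inverse.obj T),
      mk f t = x ∧ mk g t = y ∧ mk h t = z :=
  exists_triple p.inverse x y z

theorem mk_congr {f g : T ⟶ underlying O}
    (h : ∀ c (s : T.obj c), (f.app c s : O.obj c) = g.app c s) : mk f t = mk g t := by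
  have : f = g := by
    ext c s
    exact h c s
  rw [this]

instance : CommSemiring (Stalk O p) where
  nsmul := nsmulRec
  add_assoc x y z := by
    obtain ⟨T, f, g, h, t, rfl, rfl, rfl⟩ := exists_mk x y z
    simp only [add_mk]
    exact mk_congr t fun c s => add_assoc (G := O.obj c) _ _ _
  add_comm x y := by
    obtain ⟨T, f, g, h, t, rfl, rfl, -⟩ := exists_mk x y y
    simp only [add_mk]
    exact mk_congr t fun c s => add_comm (G := O.obj c) _ _
  zero_add x := by
    obtain ⟨T, f, g, h, t, rfl, -, -⟩ := exists_mk x x x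
    simp only [zero_mk t, add_mk]
    exact mk_congr t fun c s => zero_add (M := O.obj c) _
  add_zero x := by
    obtain ⟨T, f, g, h, t, rfl, -, -⟩ := exists_mk x x x
    simp only [zero_mk t, add_mk]
    exact mk_congr t fun c s => add_zero (M := O.obj c) _
  mul_assoc x y z := by
    obtain ⟨T, f, g, h, t, rfl, rfl, rfl⟩ := exists_mk x y z
    simp only [mul_mk]
    exact mk_congr t fun c s => mul_assoc (G := O.obj c) _ _ _
  mul_comm x y := by
    obtain ⟨T, f, g, h, t, rfl, rfl, -⟩ := exists_mk x y y
    simp only [mul_mk]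
    exact mk_congr t fun c s => mul_comm (G := O.obj c) _ _
  one_mul x := by
    obtain ⟨T, f, g, h, t, rfl, -, -⟩ := exists_mk x x x
    simp only [one_mk t, mul_mk]
    exact mk_congr t fun c s => one_mul (M := O.obj c) _
  mul_one x := by
    obtain ⟨T, f, g, h, t, rfl, -, -⟩ := exists_mk x x x
    simp only [one_mk t, mul_mk]
    exact mk_congr t fun c s => mul_one (M := O.obj c) _
  zero_mul x := by
    obtain ⟨T, f, g, h, t, rfl, -, -⟩ := exists_mk x x x
    simp only [zero_mk t, mul_mk]
    exact mk_congr t fun c s => zero_mul (M₀ := O.obj c) _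
  mul_zero x := by
    obtain ⟨T, f, g, h, t, rfl, -, -⟩ := exists_mk x x x
    simp only [zero_mk t, mul_mk]
    exact mk_congr t fun c s => mul_zero (M₀ := O.obj c) _
  left_distrib x y z := by
    obtain ⟨T, f, g, h, t, rfl, rfl, rfl⟩ := exists_mk x y z
    simp only [add_mk, mul_mk]
    exact mk_congr t fun c s => mul_add (R := O.obj c) _ _ _
  right_distrib x y z := by
    obtain ⟨T, f, g, h, t, rfl, rfl, rfl⟩ := exists_mk x y z
    simp only [add_mk, mul_mk]
    exact mk_congr t fun c s => add_mul (R := O.obj c) _ _ _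

end Stalk

end Stalk

/-! ### The site -/

/-- A (possibly empty) bounded open interval of the half-line `[0,∞)`. -/
structure Interval where
  carrier : Set ℝ≥0
  isOpen : IsOpen carrier
  ordConnected : carrier.OrdConnected
  isBounded : Bornology.IsBounded carrier

namespace Interval

instance : Membership ℝ≥0 Interval := ⟨fun V x => x ∈ V.carrier⟩

instance : HasSubset Interval := ⟨fun U V => U.carrier ⊆ V.carrier⟩

/-- The morphisms `U ⟶ V` are the integers `n ≥ 1` with `n U ⊆ V` if `U` is nonempty; there is
exactly one morphism `U ⟶ V`, labelled by `1`, if `U` is empty. -/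
def Mor (U V : Interval) : Type :=
  {n : ℕ+ // (∀ x ∈ U, (n : ℝ≥0) * x ∈ V) ∧ (U.carrier = ∅ → n = 1)}

open Classical in
/-- Composition is the product of integers (unless the source is empty). -/
def Mor.comp {U V W : Interval} (f : Mor U V) (g : Mor V W) : Mor U W :=
  ⟨if U.carrier = ∅ then 1 else g.1 * f.1, by
    refine ⟨fun x hx => ?_, fun h => if_pos h⟩
    have h : U.carrier ≠ ∅ := Set.nonempty_iff_ne_empty.mp ⟨x, hx⟩
    have := g.2.1 _ (f.2.1 x hx)
    rw [if_neg h]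
    simpa [mul_assoc] using this⟩

theorem Mor.ext {U V : Interval} {f g : Mor U V}
    (h : U.carrier ≠ ∅ → f.1 = g.1) : f = g := by
  apply Subtype.ext
  by_cases hU : U.carrier = ∅
  · rw [f.2.2 hU, g.2.2 hU]
  · exact h hU

theorem Mor.target_ne {U V : Interval} (f : Mor U V) (h : U.carrier ≠ ∅) : V.carrier ≠ ∅ := by
  obtain ⟨x, hx⟩ := Set.nonempty_iff_ne_empty.mpr h
  exact Set.nonempty_iff_ne_empty.mp ⟨_, f.2.1 x hx⟩

theorem Mor.comp_val {U V W : Interval} (f : Mor U V) (g : Mor V W) (h : U.carrier ≠ ∅) :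
    (f.comp g).1 = g.1 * f.1 := if_neg h

/-- The identity is `1`. -/
def Mor.id (U : Interval) : Mor U U := ⟨1, fun x hx => by simpa using hx, fun _ => rfl⟩

theorem Mor.id_val (U : Interval) : (Mor.id U).1 = 1 := rfl

/-- The small category of bounded open intervals of `[0,∞)`. -/
instance : SmallCategory Interval where
  Hom := Mor
  id := Mor.id
  comp := Mor.comp
  id_comp f := Mor.ext fun h => by rw [Mor.comp_val _ _ h, Mor.id_val, mul_one]
  comp_id f := Mor.ext fun h => by rw [Mor.comp_val _ _ h, Mor.id_val, one_mul]
  assoc f g k := Mor.ext fun h => by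
    rw [Mor.comp_val _ _ h, Mor.comp_val _ _ h, Mor.comp_val _ _ h,
      Mor.comp_val _ _ (f.target_ne h), mul_assoc]

/-- The integer that labels a morphism. -/
def mult {U V : Interval} (f : U ⟶ V) : ℕ+ := f.1

theorem mult_mem {U V : Interval} (f : U ⟶ V) {x : ℝ≥0} (hx : x ∈ U) :
    (mult f : ℝ≥0) * x ∈ V := f.2.1 x hx

theorem mult_id (U : Interval) : mult (𝟙 U) = 1 := rfl

theorem mult_comp {U V W : Interval} (f : U ⟶ V) (g : V ⟶ W) {x : ℝ≥0} (hx : x ∈ U) :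
    mult (f ≫ g) = mult g * mult f :=
  Mor.comp_val f g (Set.nonempty_iff_ne_empty.mp ⟨x, hx⟩)

theorem hom_ext {U V : Interval} {f g : U ⟶ V} (h : ∀ x ∈ U, mult f = mult g) : f = g :=
  Mor.ext fun hU => by
    obtain ⟨x, hx⟩ := Set.nonempty_iff_ne_empty.mpr hU
    exact h x hx

/-- The inclusion `U ⟶ V` of an interval `U ⊆ V`, labelled by `1`. -/
def incl {U V : Interval} (h : U ⊆ V) : U ⟶ V :=
  ⟨1, fun x hx => by
    have : x ∈ V := h hx
    simpa using this, fun _ => rfl⟩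

/-- The interval of the `x ∈ U` with `n x ∈ V`. -/
def restrict (n : ℕ+) (U V : Interval) : Interval where
  carrier := U.carrier ∩ (fun x => (n : ℝ≥0) * x) ⁻¹' V.carrier
  isOpen := U.isOpen.inter (V.isOpen.preimage (by fun_prop))
  ordConnected := U.ordConnected.inter
    (V.ordConnected.preimage_mono fun a b h => by
      show (n : ℝ≥0) * a ≤ (n : ℝ≥0) * b
      gcongr)
  isBounded := U.isBounded.subset Set.inter_subset_left

/-- The topology generated by ordinary covers: a sieve on `V` is covering if the inclusions
`U ⊆ V` that belong to it cover `V`. -/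
def topology : GrothendieckTopology Interval where
  sieves V := {S | ∀ x ∈ V, ∃ (U : Interval) (h : U ⊆ V), x ∈ U ∧ S (incl h)}
  top_mem' V x hx := ⟨V, fun _ h => h, hx, trivial⟩
  pullback_stable' V W S f hS x hx := by
    obtain ⟨U, hU, hxU, hSU⟩ := hS _ (mult_mem f hx)
    refine ⟨restrict (mult f) W U, fun _ h => h.1, ⟨hx, hxU⟩, ?_⟩
    let g : restrict (mult f) W U ⟶ U :=
      ⟨mult f, fun y hy => hy.2, fun h => absurd h (Set.nonempty_iff_ne_empty.mp ⟨x, hx, hxU⟩)⟩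
    have hg : incl (U := restrict (mult f) W U) (V := W) (fun _ h => h.1) ≫ f = g ≫ incl hU :=
      hom_ext fun y hy => by
        rw [mult_comp _ _ hy, mult_comp _ _ hy]
        show mult f * 1 = 1 * mult f
        rw [mul_one, one_mul]
    show S _
    rw [hg]
    exact S.downward_closed hSU g
  transitive' V S hS R hR x hx := by
    obtain ⟨U, hU, hxU, hSU⟩ := hS x hx
    obtain ⟨W, hW, hxW, hRW⟩ := hR hSU x hxU
    refine ⟨W, fun _ h => hU (hW h), hxW, ?_⟩
    have : incl hW ≫ incl hU = incl (U := W) (V := V) (fun _ h => hU (hW h)) :=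
      hom_ext fun y hy => by rw [mult_comp _ _ hy]; rfl
    have h : R (incl hW ≫ incl hU) := hRW
    rwa [this] at h

end Interval

/-- The topos `[0,∞) ⋊ ℕ^×`. -/
abbrev HalfLineTopos := Sheaf Interval.topology Type

/-- The flat continuous functor `V ↦ p^* (a y V)` of a point `p` of the topos `[0,∞) ⋊ ℕ^×`, where
`a y V` is the sheaf represented by `V`. -/
def fiber (p : ToposPoint HalfLineTopos) : Interval ⥤ Type :=
  yoneda ⋙ presheafToSheaf Interval.topology Type ⋙ p.inverse

/-- An element `x ∈ F(V)` is located at `l ∈ V` if it comes from `F(U)` for every interval `U ⊆ V`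
that contains `l`. -/
def LocatedAt (F : Interval ⥤ Type) {V : Interval} (x : F.obj V) (l : ℝ≥0) : Prop :=
  l ∈ V ∧ ∀ (U : Interval) (h : U ⊆ V), l ∈ U → ∃ z : F.obj U, F.map (Interval.incl h) z = x

/-- The support of a point of `[0,∞) ⋊ ℕ^×`: the set of all locations of elements of its
functor. -/
def support (p : ToposPoint HalfLineTopos) : Set ℝ≥0 :=
  {l | ∃ (V : Interval) (x : (fiber p).obj V), LocatedAt (fiber p) x l}

/-- An abelian group has rank one if its tensor product with `ℚ` has dimension one. -/
def IsRankOne (H : Type*) [AddCommGroup H] : Prop := Module.rank ℤ H = 1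

/-- The functor `F_H(V) = V ∩ H ∩ (0,∞)` of a subgroup `H` of `ℝ`. -/
def subgroupFunctor (H : AddSubgroup ℝ) : Interval ⥤ Type where
  obj V := {h : ℝ≥0 // h ∈ V ∧ (h : ℝ) ∈ H ∧ 0 < h}
  map f := TypeCat.ofHom fun h => ⟨(Interval.mult f : ℝ≥0) * h.1, Interval.mult_mem f h.2.1, by
    have := H.nsmul_mem h.2.2.1 (Interval.mult f : ℕ)
    simpa [nsmul_eq_mul] using this, mul_pos (by simp) h.2.2.2⟩
  map_id V := by
    ext h
    simp [Interval.mult_id]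
  map_comp f g := by
    ext h
    simp [Interval.mult_comp f g h.2.1, mul_assoc]

section OrderedGroup

variable (H : Type) [AddCommGroup H] [LinearOrder H] [IsOrderedAddMonoid H]

/-- The functor `F'_H` of a totally ordered abelian group `H`: `F'_H(V)` is `H_+ = {h > 0}` if
`0 ∈ V`, and is empty otherwise; the morphism labelled by `n` acts as multiplication by `n`. -/
def orderedGroupFunctor : Interval ⥤ Type where
  obj V := {h : H // 0 < h ∧ (0 : ℝ≥0) ∈ V}
  map f := TypeCat.ofHom fun h => ⟨(Interval.mult f : ℕ) • h.1,
    nsmul_pos h.2.1 (Interval.mult f).pos.ne',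
    by simpa using Interval.mult_mem f h.2.2⟩
  map_id V := by
    ext h
    simp [Interval.mult_id]
  map_comp f g := by
    ext h
    simp [Interval.mult_comp f g h.2.2, mul_nsmul']

/-- The integer that labels a morphism of the one-object category `ℕ^×`. -/
def label {X Y : SingleObj ℕ+} (n : X ⟶ Y) : ℕ+ := n

theorem label_id (X : SingleObj ℕ+) : label (𝟙 X) = 1 := rfl

theorem label_comp {X Y Z : SingleObj ℕ+} (m : X ⟶ Y) (n : Y ⟶ Z) :
    label (m ≫ n) = label n * label m := rfl

/-- The action of `ℕ^×` on the set `H_+ = {h > 0}`. -/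
def positiveCone : SingleObj ℕ+ ⥤ Type where
  obj _ := {h : H // 0 < h}
  map n := TypeCat.ofHom fun h => ⟨(label n : ℕ) • h.1, nsmul_pos h.2 (label n).pos.ne'⟩
  map_id V := by
    ext h
    simp [label_id]
  map_comp f g := by
    ext h
    simp [label_comp, mul_nsmul']

end OrderedGroup

/-! ### The arithmetic site and its points over `ℝ_max` -/

/-- The topos of sets with an action of the monoid `ℕ^×`. -/
abbrev ArithmeticTopos := (SingleObj ℕ+)ᵒᵖ ⥤ Type

/-- The structure sheaf of the arithmetic site: the semifield `ℤ_max`, on which `n ∈ ℕ^×` acts by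
the Frobenius endomorphism `Fr_n`. -/
def structureSheaf : (SingleObj ℕ+)ᵒᵖ ⥤ CommSemiRingCat.{0} where
  obj _ := CommSemiRingCat.of (MaxPlus ℤ)
  map n := CommSemiRingCat.ofHom (MaxPlus.frobenius (label n.unop))
  map_id X := by
    ext x
    exact pow_one (M := MaxPlus ℤ) x
  map_comp m n := by
    ext x
    exact pow_mul (M := MaxPlus ℤ) x _ _

/-- A point of the arithmetic site over a semiring `R`: a morphism of semiringed toposes from the
topos of sets endowed with `R` to the arithmetic site, that is, a point of the underlying topos with
a local morphism of semirings from the stalk of the structure sheaf to `R`. -/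
structure ArithmeticPoint (R : Type) [CommSemiring R] where
  point : ToposPoint ArithmeticTopos
  hom : Stalk structureSheaf point →+* R
  isLocal : IsLocalHom hom

/-- Two points over `R` are isomorphic if there is an isomorphism of the underlying points of the
topos that is compatible with the morphisms to `R`. -/
instance ArithmeticPoint.setoid (R : Type) [CommSemiring R] : Setoid (ArithmeticPoint R) where
  r x y := ∃ e : x.point.inverse ≅ y.point.inverse,
    ∀ s : x.point.inverse.obj (underlying structureSheaf), y.hom (e.hom.app _ s) = x.hom s
  iseqv :=
    { refl := fun x => ⟨Iso.refl _, fun s => rfl⟩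
      symm := fun {x y} ⟨e, h⟩ => ⟨e.symm, fun s => by
        rw [← h]
        congr 1
        exact Iso.inv_hom_id_apply (e.app _) s⟩
      trans := fun {x y z} ⟨e, h⟩ ⟨f, h'⟩ => ⟨e.trans f, fun s => by
        rw [← h, ← h']
        rfl⟩ }

/-- The set `A(R)` of isomorphism classes of points of the arithmetic site over `R`. -/
abbrev ArithmeticPoint.IsoClass (R : Type) [CommSemiring R] :=
  Quotient (ArithmeticPoint.setoid R)

/-- The point `x` over `ℝ_max` corresponds to the subgroup `H` of `ℝ`: the image of the stalk of the
structure sheaf is `H_max`. -/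
def ArithmeticPoint.IsOfSubgroup (x : ArithmeticPoint (MaxPlus ℝ)) (H : AddSubgroup ℝ) : Prop :=
  Set.range x.hom = insert 0 (MaxPlus.of '' (H : Set ℝ))

/-- The point `x` over `ℝ_max` is the one defined over the Boolean semifield `𝔹 = {0, 1}` that
corresponds to the totally ordered group `H`: the underlying point of the topos is given by the flat
functor `H_+`, and the morphism of semirings takes its values in `{0, 1}`. -/
def ArithmeticPoint.IsOfOrderedGroup (x : ArithmeticPoint (MaxPlus ℝ)) (H : Type) [AddCommGroup H]
    [LinearOrder H] [IsOrderedAddMonoid H] : Prop :=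
  Nonempty (yoneda ⋙ x.point.inverse ≅ positiveCone H) ∧ ∀ s, x.hom s = 0 ∨ x.hom s = 1

/-- The point `p` of `[0,∞) ⋊ ℕ^×` is the point `𝔭_H` of the subgroup `H` of `ℝ`: its flat
continuous functor is isomorphic to `F_H`. -/
def IsOfSubgroup (p : ToposPoint HalfLineTopos) (H : AddSubgroup ℝ) : Prop :=
  Nonempty (fiber p ≅ subgroupFunctor H)

/-- The point `p` of `[0,∞) ⋊ ℕ^×` is the point `𝔮_H` of the ordered group `H`: its flat
continuous functor is isomorphic to `F'_H`. -/
def IsOfOrderedGroup (p : ToposPoint HalfLineTopos) (H : Type) [AddCommGroup H]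
    [LinearOrder H] [IsOrderedAddMonoid H] : Prop :=
  Nonempty (fiber p ≅ orderedGroupFunctor H)

/-! ### The adele class space -/

/-- The ring `𝔸_f` of finite adeles of `ℚ`. -/
abbrev FiniteAdele := IsDedekindDomain.FiniteAdeleRing ℤ ℚ

/-- The ring of adeles of `ℚ`. -/
abbrev Adele := NumberField.AdeleRing ℤ ℚ

/-- The subring `Ẑ` of integral finite adeles. -/
def zhat : Subring FiniteAdele where
  carrier := {a | ∀ v, a v ∈ v.adicCompletionIntegers ℚ}
  mul_mem' ha hb v := mul_mem (ha v) (hb v)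
  one_mem' v := one_mem (v.adicCompletionIntegers ℚ)
  add_mem' ha hb v := add_mem (ha v) (hb v)
  zero_mem' v := zero_mem (v.adicCompletionIntegers ℚ)
  neg_mem' ha v := neg_mem (ha v)

/-- The embedding `u ↦ (1, u)` of `Ẑ^*` in the adeles. -/
def zhatUnit : zhatˣ →* Adele where
  toFun u := ((1 : NumberField.InfiniteAdeleRing ℚ), ((u : zhat) : FiniteAdele))
  map_one' := rfl
  map_mul' _ _ := Prod.ext (mul_one _).symm rfl

/-- The equivalence relation on adeles with quotient `ℚ^× \ 𝔸 / Ẑ^*`. -/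
instance adeleClassSetoid : Setoid Adele where
  r a b := ∃ (q : ℚˣ) (u : zhatˣ), b = algebraMap ℚ Adele q * a * zhatUnit u
  iseqv :=
    { refl := fun a => ⟨1, 1, by simp⟩
      symm := fun {a b} ⟨q, u, h⟩ => ⟨q⁻¹, u⁻¹, by
        have h1 : algebraMap ℚ Adele (q⁻¹ : ℚˣ) * algebraMap ℚ Adele q = 1 := by
          rw [← map_mul, Units.inv_mul, map_one]
        have h2 : zhatUnit u * zhatUnit u⁻¹ = 1 := by
          rw [← map_mul, mul_inv_cancel, map_one]
        calc a = (algebraMap ℚ Adele (q⁻¹ : ℚˣ) * algebraMap ℚ Adele q) * a *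
              (zhatUnit u * zhatUnit u⁻¹) := by rw [h1, h2, one_mul, mul_one]
          _ = _ := by rw [h]; ring⟩
      trans := fun {a b c} ⟨q, u, h⟩ ⟨q', u', h'⟩ => ⟨q' * q, u * u', by
        rw [h', h, Units.val_mul, map_mul, map_mul]
        ring⟩ }

/-- The sector `ℚ^× \ 𝔸 / Ẑ^*` of the adele class space. -/
abbrev AdeleClass := Quotient adeleClassSetoid

/-- The subgroup `H_a = {q ∈ ℚ | q a ∈ Ẑ}` of `ℚ` for a finite adele `a`. -/
def finiteAdeleGroup (a : FiniteAdele) : AddSubgroup ℚ where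
  carrier := {q | algebraMap ℚ FiniteAdele q * a ∈ zhat}
  zero_mem' := by simp [zero_mem]
  add_mem' {q r} hq hr := by
    show algebraMap ℚ FiniteAdele (q + r) * a ∈ zhat
    rw [map_add, add_mul]
    exact add_mem hq hr
  neg_mem' {q} hq := by
    show algebraMap ℚ FiniteAdele (-q) * a ∈ zhat
    rw [map_neg, neg_mul]
    exact neg_mem hq

/-- The absolute value of the archimedean component of an adele. -/
def archimedeanAbs (a : Adele) : ℝ := ‖a.1 Rat.infinitePlace‖

/-- The subgroup `|a_∞| H_{a_f}` of `ℝ`. -/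
def adeleSubgroup (a : Adele) : AddSubgroup ℝ :=
  (finiteAdeleGroup a.2).map
    ((AddMonoidHom.mulLeft (archimedeanAbs a)).comp (Rat.castHom ℝ).toAddMonoidHom)

end ScalingTopos

end

open ScalingTopos

/-! Points of both toposes are described by the same data: an ordered group `H` of rank one with an
`ℕ^×`-equivariant map `ℓ : H_+ → [0,∞)` (`PosMap`), up to isomorphism of positive cones over the
half-line.

A point of the half-line topos is a flat functor `F` on intervals that sends covers to jointly
surjective families. Continuity and flatness give every element of `F(V)` exactly one location in
`V`. Flatness also makes any two elements multiples of a common one, so each has a rational degree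
relative to a fixed element (`IsFlatRelation.exists_degree`). Degree and location identify `F` with
`V ↦ ℓ⁻¹(V)` (`IsFlatContinuous.exists_iso_linear`).

On the arithmetic site, flatness alone produces `H_+`. A morphism from the stalk to `ℝ_max` is, on
the copy of `ℤ_max` formed by the germs at one element, of the form `k ↦ k r` with `r ≥ 0`
(`MaxPlus.eq_scale`); the Frobenius action makes `r` an equivariant function. Locality is automatic,
since every nonzero germ is invertible.

Replacing `H` by a nonzero subgroup `K` of `ℚ`, the map `ℓ` is `k ↦ c k` with `c ≥ 0`, and `(K, c)`
is unique up to a positive rational factor (`PosMap.linear_isIsoTo_iff`). If `c > 0`, the data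
amount to the subgroup `c K` of `ℝ`; if `c = 0`, only the ordered group is left. The support is the
image of `ℓ`, so it avoids `0` in the first case and is `{0}` in the second.

An adele `a` gives the pair `(H_a, |a_∞|)`. Nonzero subgroups of `ℚ` are described place by place,
hence are all of the form `H_a`, and `H_a` determines the valuations of `a_f`, that is, `a_f` up to
`Ẑ^*`. The sign lost in `|a_∞|` is restored by `-1 ∈ ℚ^×`, whose action on the finite part is
absorbed by `Ẑ^*` (`adeleMap_isIsoTo_iff`). -/

noncomputable section

namespace ScalingTopos

open CategoryTheory Opposite
open scoped NNReal

section

/-! ### Exact cocontinuous functors on presheaves and their values on representables -/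

section Representables

variable {C : Type} [SmallCategory C] (G : (Cᵒᵖ ⥤ Type) ⥤ Type)

/-- Every element of `G P` is the image of an element of `G` of a representable presheaf. -/
theorem exists_representable [Limits.PreservesColimitsOfSize.{0, 0} G] {P : Cᵒᵖ ⥤ Type}
    (t : G.obj P) :
    ∃ (c : C) (s : P.obj (op c)) (z : G.obj (yoneda.obj c)),
      G.map (yonedaEquiv.symm s) z = t := by
  -- `P` is the colimit of the representables over it, `G` preserves this colimit, and an element of
  -- a colimit of sets comes from one of the stages.
  obtain ⟨j, z, hz⟩ := Limits.Types.jointly_surjective_of_isColimit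
    (Limits.isColimitOfPreserves G (Presheaf.isColimitTautologicalCocone P)) t
  refine ⟨j.left, yonedaEquiv j.hom, z, ?_⟩
  rw [Equiv.symm_apply_apply]
  exact hz

/-- Colimit-preserving functors on presheaves that agree on representables are isomorphic. -/
theorem exists_iso_of_iso_representables {G G' : (Cᵒᵖ ⥤ Type) ⥤ Type}
    [Limits.PreservesColimitsOfSize.{0, 0} G] [Limits.PreservesColimitsOfSize.{0, 0} G']
    (e : yoneda ⋙ G ≅ yoneda ⋙ G') :
    ∃ E : G ≅ G', ∀ c, E.hom.app (yoneda.obj c) = e.hom.app c := by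
  let u : uliftYoneda.{0} (C := C) ≅ yoneda := uliftYonedaIsoYoneda
  let e' : uliftYoneda.{0} (C := C) ⋙ G ≅ uliftYoneda.{0} ⋙ G' :=
    Functor.isoWhiskerRight u G ≪≫ e ≪≫ Functor.isoWhiskerRight u.symm G'
  -- A cocontinuous functor is the left Kan extension of its restriction along the Yoneda embedding,
  -- so an isomorphism of restrictions extends. The universe-lifted embedding is used here and
  -- removed through `u`.
  have h1 := Presheaf.isLeftKanExtension_of_preservesColimits.{0} G (Iso.refl _)
  have h2 := Presheaf.isLeftKanExtension_of_preservesColimits.{0} G' (Iso.refl _)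
  let E := Functor.leftKanExtensionUniqueOfIso G (Iso.refl (uliftYoneda.{0} ⋙ G)).hom e' G'
    (Iso.refl (uliftYoneda.{0} ⋙ G')).hom
  refine ⟨E, fun c => ?_⟩
  have h : E.hom.app (uliftYoneda.{0}.obj c) = e'.hom.app c := by
    have := congr_app (Functor.descOfIsLeftKanExtension_fac G
      (Iso.refl (uliftYoneda.{0} ⋙ G)).hom G' (e'.hom ≫ (Iso.refl _).hom)) c
    simpa [E] using this
  have hn := E.hom.naturality (u.hom.app c)
  have : E.hom.app (yoneda.obj c) = G.map (u.inv.app c) ≫ E.hom.app (uliftYoneda.{0}.obj c) ≫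
      G'.map (u.hom.app c) := by
    rw [← hn, ← Category.assoc, ← Functor.map_comp]
    simp
  rw [this, h]
  simp only [e', Iso.trans_hom, Functor.isoWhiskerRight_hom, NatTrans.comp_app,
    Functor.whiskerRight_app, Category.assoc, ← Functor.map_comp, Iso.symm_hom]
  rw [← Category.assoc, ← Functor.map_comp]
  simp

variable [Limits.PreservesFiniteLimits G] [Limits.PreservesColimitsOfSize.{0, 0} G]

theorem exists_element : ∃ c, Nonempty (G.obj (yoneda.obj c)) := by
  obtain ⟨c, -, z, -⟩ := exists_representable G (pt G)
  exact ⟨c, ⟨z⟩⟩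

theorem map_yoneda_comp {P : Cᵒᵖ ⥤ Type} {c d : C} (f : c ⟶ d) (s : P.obj (op d)) :
    yoneda.map f ≫ yonedaEquiv.symm s = yonedaEquiv.symm (P.map f.op s) := by
  exact (yonedaEquiv_symm_map f.op s).symm

/-- Two elements of the fibers have a common refinement. -/
theorem exists_span {P Q : Cᵒᵖ ⥤ Type} (x : G.obj P) (y : G.obj Q) :
    ∃ (e : C) (s : P.obj (op e)) (t : Q.obj (op e)) (z : G.obj (yoneda.obj e)),
      G.map (yonedaEquiv.symm s) z = x ∧ G.map (yonedaEquiv.symm t) z = y := by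
  -- Since `G` preserves products, the two elements form one element over `P × Q`, which comes from
  -- a representable.
  obtain ⟨p, ⟨rfl, rfl⟩, -⟩ := existsUnique_pair G x y
  obtain ⟨e, s, z, rfl⟩ := exists_representable G p
  refine ⟨e, s.1, s.2, z, ?_, ?_⟩
  · rw [← Functor.map_comp_apply]
    congr 2
  · rw [← Functor.map_comp_apply]
    congr 2

/-- Two parallel maps that agree on an element of the fiber are equalized by a refinement. -/
theorem exists_equalizing {P : Cᵒᵖ ⥤ Type} {c : C} (s t : P.obj (op c))
    (x : G.obj (yoneda.obj c))
    (h : G.map (yonedaEquiv.symm s) x = G.map (yonedaEquiv.symm t) x) :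
    ∃ (e : C) (f : e ⟶ c) (z : G.obj (yoneda.obj e)),
      G.map (yoneda.map f) z = x ∧ P.map f.op s = P.map f.op t := by
  let a : yoneda.obj c ⟶ P := yonedaEquiv.symm s
  let b : yoneda.obj c ⟶ P := yonedaEquiv.symm t
  -- Since `G` preserves equalizers, `x` lifts to the equalizer of `a` and `b`, and from there to a
  -- representable.
  have hl := Limits.isLimitForkMapOfIsLimit G _ (Limits.equalizerIsEqualizer a b)
  obtain ⟨l, hl⟩ := Limits.Fork.IsLimit.lift' hl (TypeCat.ofHom fun _ : PUnit => x)
    (by ext; exact h)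
  obtain ⟨e, s', z, hz⟩ := exists_representable G (l PUnit.unit)
  let g : yoneda.obj e ⟶ yoneda.obj c := yonedaEquiv.symm s' ≫ Limits.equalizer.ι a b
  have hg : g ≫ a = g ≫ b := by
    rw [Category.assoc, Category.assoc, Limits.equalizer.condition a b]
  have hf : yoneda.map (yoneda.preimage g) = g := yoneda.map_preimage g
  refine ⟨e, yoneda.preimage g, z, ?_, ?_⟩
  · rw [hf]
    simp only [g, Functor.map_comp_apply, hz]
    exact ConcreteCategory.congr_hom hl PUnit.unit
  · rw [← hf] at hg
    simp only [a, b, map_yoneda_comp] at hg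
    exact yonedaEquiv.symm.injective hg

end Representables
end

section

/-! ### Flat actions of the multiplicative monoid -/

/-- A relation `R m z x`, to be thought of as `x = m z`, is flat if any two elements are multiples
of a third one, and the multiplier is determined by the elements. -/
structure IsFlatRelation {S : Type} (R : ℕ+ → S → S → Prop) : Prop where
  nonempty : Nonempty S
  directed : ∀ x y, ∃ z m n, R m z x ∧ R n z y
  free : ∀ {m n z x}, R m z x → R n z x → m = n
  comp : ∀ {m n w z x}, R m z x → R n w z → R (m * n) w x
  exists_multiple : ∀ n z, ∃ x, R n z x

namespace IsFlatRelation

variable {S : Type} {R : ℕ+ → S → S → Prop} (h : IsFlatRelation R)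
include h

/-- This says that the ratio `m / n` of `x` to `x₀` does not depend on the common divisor used to
compute it: two divisors are compared through a common divisor of both, and multipliers are unique.
-/
theorem mul_eq_mul {m m' n n' : ℕ+} {z z' x x₀ : S} (hx : R m z x) (hx₀ : R n z x₀)
    (hx' : R m' z' x) (hx₀' : R n' z' x₀) : m * n' = m' * n := by
  obtain ⟨w, a, b, ha, hb⟩ := h.directed z z'
  have h1 := h.free (h.comp hx ha) (h.comp hx' hb)
  have h2 := h.free (h.comp hx₀ ha) (h.comp hx₀' hb)
  have : (m * n') * (a * b) = (m' * n) * (a * b) := by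
    calc (m * n') * (a * b) = (m * a) * (n' * b) := mul_mul_mul_comm _ _ _ _
      _ = (m' * b) * (n * a) := by rw [h1, h2]
      _ = (m' * n) * (b * a) := mul_mul_mul_comm _ _ _ _
      _ = _ := by rw [mul_comm b a]
  exact mul_right_cancel this

/-- The degree `φ` is the ratio to a fixed element `x₀`. Its values are the positive elements of a
subgroup of `ℚ`, and it separates elements as far as the relation does: equal degrees mean the same
multiple of one element. Both classifications of points start from this. -/
theorem exists_degree :
    ∃ (φ : S → ℚ) (K : AddSubgroup ℚ), K ≠ ⊥ ∧ (∀ x, 0 < φ x) ∧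
      (∀ m z x, R m z x → φ x = (m : ℚ) * φ z) ∧ (∀ x, φ x ∈ K) ∧
      (∀ k ∈ K, 0 < k → ∃ x, φ x = k) ∧
      (∀ x y, φ x = φ y → ∃ z m, R m z x ∧ R m z y) := by
  obtain ⟨x₀⟩ := h.nonempty
  choose z m n hm hn using fun x => h.directed x x₀
  let φ : S → ℚ := fun x => (m x : ℚ) / n x
  have pos (k : ℕ+) : (0 : ℚ) < k := by exact_mod_cast k.pos
  have key {a b : ℕ+} {w x : S} (ha : R a w x) (hb : R b w x₀) : φ x = (a : ℚ) / b := by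
    have := h.mul_eq_mul (hm x) (hn x) ha hb
    rw [div_eq_div_iff (pos _).ne' (pos _).ne']
    exact_mod_cast this
  have hφ : ∀ x, 0 < φ x := fun x => div_pos (pos _) (pos _)
  have hmul : ∀ a w x, R a w x → φ x = (a : ℚ) * φ w := by
    intro a w x hx
    rw [key (h.comp hx (hm w)) (hn w)]
    simp only [φ]
    push_cast
    ring
  -- The integer multiples of single degrees are closed under addition because two elements have a
  -- common divisor.
  let K : AddSubgroup ℚ :=
    { carrier := {q | ∃ (x : S) (k : ℤ), q = k * φ x}
      zero_mem' := ⟨x₀, 0, by simp⟩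
      neg_mem' := by
        rintro _ ⟨x, k, rfl⟩
        exact ⟨x, -k, by push_cast; ring⟩
      add_mem' := by
        rintro _ _ ⟨x, k, rfl⟩ ⟨y, l, rfl⟩
        obtain ⟨w, a, b, ha, hb⟩ := h.directed x y
        refine ⟨w, k * a + l * b, ?_⟩
        rw [hmul _ _ _ ha, hmul _ _ _ hb]
        push_cast
        ring }
  have hK : ∀ x, φ x ∈ K := fun x => ⟨x, 1, by simp⟩
  refine ⟨φ, K, fun hbot => ?_, hφ, hmul, hK, ?_, ?_⟩
  · have := hK x₀
    rw [hbot, AddSubgroup.mem_bot] at this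
    exact (hφ x₀).ne' this
  · rintro _ ⟨x, k, rfl⟩ hk
    have hk' : 0 < k := by exact_mod_cast pos_of_mul_pos_left hk (hφ x).le
    obtain ⟨y, hy⟩ := h.exists_multiple ⟨k.toNat, by omega⟩ x
    refine ⟨y, ?_⟩
    rw [hmul _ _ _ hy]
    congr 1
    have : ((k.toNat : ℤ) : ℚ) = k := by rw [Int.toNat_of_nonneg hk'.le]
    exact_mod_cast this
  · intro x y hxy
    obtain ⟨w, a, b, ha, hb⟩ := h.directed x y
    have : a = b := by
      rw [hmul _ _ _ ha, hmul _ _ _ hb] at hxy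
      exact_mod_cast mul_right_cancel₀ (hφ w).ne' hxy
    exact ⟨w, a, ha, this ▸ hb⟩

end IsFlatRelation

/-! ### Positive cones of ordered groups of rank one -/

/-- The set of positive elements of an ordered group. -/
abbrev Pos (H : Type) [AddCommGroup H] [LinearOrder H] : Type := {h : H // 0 < h}

section Pos

variable {H H' : Type} [AddCommGroup H] [LinearOrder H] [IsOrderedAddMonoid H]
  [AddCommGroup H'] [LinearOrder H'] [IsOrderedAddMonoid H']

instance : SMul ℕ+ (Pos H) := ⟨fun n h => ⟨(n : ℕ) • h.1, nsmul_pos h.2 n.pos.ne'⟩⟩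

theorem Pos.coe_smul (n : ℕ+) (h : Pos H) : ((n • h : Pos H) : H) = (n : ℕ) • (h : H) := rfl

theorem Pos.mul_smul (m n : ℕ+) (h : Pos H) : (m * n) • h = m • n • h :=
  Subtype.ext (by simp [Pos.coe_smul, mul_nsmul'])

theorem zsmul_pos_iff_left {x : H} (hx : 0 < x) {n : ℤ} : 0 < n • x ↔ 0 < n := by
  simpa using zsmul_lt_zsmul_iff_left hx (m := 0) (n := n)

theorem zsmul_pos_iff {n : ℤ} (hn : 0 < n) {x : H} : 0 < n • x ↔ 0 < x := by
  simpa using zsmul_lt_zsmul_iff_right hn (a := (0 : H)) (b := x)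

/-- The elements of a group of rank one are commensurable. -/
theorem IsRankOne.exists_zsmul_eq (hH : IsRankOne H) (x y : H) (hx : x ≠ 0) :
    ∃ m n : ℤ, m ≠ 0 ∧ m • y = n • x := by
  by_contra! hcon
  have hli : LinearIndependent ℤ ![x, y] := by
    rw [LinearIndependent.pair_iff]
    intro s t hst
    have ht : t = 0 := by
      by_contra ht
      refine hcon t (-s) ht ?_
      rw [neg_smul]
      exact eq_neg_of_add_eq_zero_right hst
    refine ⟨?_, ht⟩
    rw [ht, zero_smul, add_zero] at hst
    exact (smul_eq_zero.mp hst).resolve_right hx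
  have := hli.cardinal_lift_le_rank
  unfold IsRankOne at hH
  rw [hH] at this
  simp at this

theorem IsRankOne.exists_ne_zero {H : Type} [AddCommGroup H] (hH : IsRankOne H) : ∃ x : H, x ≠ 0 := by
  by_contra! hcon
  have : Subsingleton H := ⟨fun a b => by rw [hcon a, hcon b]⟩
  unfold IsRankOne at hH
  rw [rank_subsingleton'] at hH
  exact zero_ne_one hH

theorem isRankOne_of_exists_zsmul_eq (x : H) (hx : x ≠ 0)
    (h : ∀ y : H, ∃ m n : ℤ, m ≠ 0 ∧ m • y = n • x) : IsRankOne H := by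
  apply le_antisymm
  · apply rank_le (n := 1)
    intro s hs
    by_contra! hcard
    obtain ⟨a, ha, b, hb, hab⟩ := Finset.one_lt_card.mp hcard
    obtain ⟨m, n, hm, hmn⟩ := h a
    obtain ⟨m', n', hm', hmn'⟩ := h b
    have hli : LinearIndependent ℤ ![a, b] := by
      have := hs.comp (fun i : Fin 2 => if i = 0 then ⟨a, ha⟩ else ⟨b, hb⟩) (by
        intro i j hij
        fin_cases i <;> fin_cases j <;> simp_all)
      convert this using 1
      ext i
      fin_cases i <;> simp
    rw [LinearIndependent.pair_iff] at hli
    -- Eliminating `x` from the two relations links `a` and `b`. Independence forces `n' = 0`, so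
    -- `b` is torsion, hence zero, which is absurd.
    have e1 : (n' * m) • a + (-(n * m')) • b = 0 := by
      rw [mul_smul, hmn, neg_smul, mul_smul, hmn', ← mul_smul, ← mul_smul, mul_comm n' n]
      exact add_neg_cancel _
    have h1 := hli _ _ e1
    have hn' : n' = 0 := (mul_eq_zero.mp h1.1).resolve_right hm
    rw [hn', zero_smul] at hmn'
    have hb0 := (smul_eq_zero.mp hmn').resolve_left hm'
    have := hli 0 1 (by simp [hb0])
    exact one_ne_zero this.2
  · have : LinearIndependent ℤ (fun _ : Unit => x) := by
      rw [linearIndependent_unique_iff]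
      exact hx
    have := this.cardinal_lift_le_rank
    simpa using this

/-- The subgroup generated by two commensurable elements is cyclic, and its positive generator
divides both. It is found from a relation `m y = n x` with positive coefficients, made coprime, by
Bézout. -/
theorem IsRankOne.exists_common (hH : IsRankOne H) (x y : Pos H) :
    ∃ (z : Pos H) (m n : ℕ+), m • z = x ∧ n • z = y := by
  obtain ⟨m, n, hm, hmn⟩ := hH.exists_zsmul_eq x.1 y.1 x.2.ne'
  obtain ⟨m, n, hm, hn, hmn⟩ : ∃ m n : ℤ, 0 < m ∧ 0 < n ∧ m • y.1 = n • x.1 := by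
    rcases lt_or_gt_of_ne hm with hm | hm
    · refine ⟨-m, -n, by omega, ?_, by rw [neg_smul, neg_smul, hmn]⟩
      have := zsmul_pos y.2 (by omega : 0 < -m)
      rw [neg_smul, hmn, ← neg_smul] at this
      exact (zsmul_pos_iff_left x.2).mp this
    · refine ⟨m, n, hm, ?_, hmn⟩
      have := zsmul_pos y.2 hm
      rw [hmn] at this
      exact (zsmul_pos_iff_left x.2).mp this
  -- Dividing the relation by the gcd is allowed because an ordered group is torsion-free.
  obtain ⟨g, m, n, hg, hco, rfl, rfl⟩ : ∃ g m' n' : ℤ, 0 < g ∧ IsCoprime m' n' ∧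
      m = m' * g ∧ n = n' * g := by
    obtain ⟨m', n', hco, h1, h2⟩ := Int.exists_gcd_one (m := m) (n := n)
      (Int.gcd_pos_of_ne_zero_left _ hm.ne')
    exact ⟨_, m', n', by exact_mod_cast Int.gcd_pos_of_ne_zero_left _ hm.ne',
      Int.isCoprime_iff_gcd_eq_one.mpr hco, h1, h2⟩
  have hm' : 0 < m := pos_of_mul_pos_left hm hg.le
  have hn' : 0 < n := pos_of_mul_pos_left hn hg.le
  have hmn' : m • y.1 = n • x.1 := by
    rw [mul_comm, mul_smul, mul_comm n, mul_smul] at hmn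
    exact smul_right_injective H hg.ne' hmn
  -- With `a m + b n = 1` and `m y = n x`, the element `a x + b y` has multiples `m (a x + b y) = x`
  -- and `n (a x + b y) = y`.
  obtain ⟨a, b, hab⟩ := hco
  have e1 : m • (a • x.1 + b • y.1) = x.1 := by
    calc m • (a • x.1 + b • y.1) = (a * m) • x.1 + b • (m • y.1) := by module
      _ = (a * m + b * n) • x.1 := by rw [hmn']; module
      _ = x.1 := by rw [hab, one_smul]
  have e2 : n • (a • x.1 + b • y.1) = y.1 := by
    calc n • (a • x.1 + b • y.1) = (b * n) • y.1 + a • (n • x.1) := by module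
      _ = (a * m + b * n) • y.1 := by rw [← hmn']; module
      _ = y.1 := by rw [hab, one_smul]
  refine ⟨⟨a • x.1 + b • y.1, ?_⟩, ⟨m.toNat, by omega⟩, ⟨n.toNat, by omega⟩,
    Subtype.ext ?_, Subtype.ext ?_⟩
  · have := x.2
    rw [← e1] at this
    exact (zsmul_pos_iff hm').mp this
  · show m.toNat • _ = _
    rw [← natCast_zsmul, Int.toNat_of_nonneg hm'.le, e1]
  · show n.toNat • _ = _
    rw [← natCast_zsmul, Int.toNat_of_nonneg hn'.le, e2]

theorem Pos.smul_left_injective (x : Pos H) {m n : ℕ+} (h : m • x = n • x) : m = n := by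
  have := congr_arg Subtype.val h
  rw [Pos.coe_smul, Pos.coe_smul] at this
  exact PNat.coe_injective ((nsmul_left_strictMono x.2).injective this)

theorem IsRankOne.isFlatRelation (hH : IsRankOne H) :
    IsFlatRelation fun (n : ℕ+) (z x : Pos H) => n • z = x where
  nonempty := by
    obtain ⟨x, hx⟩ := hH.exists_ne_zero
    exact ⟨⟨|x|, abs_pos.mpr hx⟩⟩
  directed := hH.exists_common
  free h h' := Pos.smul_left_injective _ (h.trans h'.symm)
  comp := by
    rintro m n w _ _ rfl rfl
    exact Pos.mul_smul _ _ _
  exists_multiple n z := ⟨_, rfl⟩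

/-- A group of rank one with a positive element `x₀` embeds in `ℚ`. -/
theorem IsRankOne.exists_orderAddMonoidHom (hH : IsRankOne H) :
    ∃ f : H →+ ℚ, StrictMono f := by
  obtain ⟨x₀⟩ := hH.isFlatRelation.nonempty
  choose m n hm hmn using fun y => hH.exists_zsmul_eq x₀.1 y x₀.2.ne'
  have hm' (y) : (m y : ℚ) ≠ 0 := by exact_mod_cast hm y
  -- The ratio `y / x₀` can be computed from any relation, which makes the map additive below.
  have key {a b : ℤ} {y : H} (ha : a ≠ 0) (hab : a • y = b • x₀.1) :
      (n y : ℚ) / m y = b / a := by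
    have ha' : (a : ℚ) ≠ 0 := by exact_mod_cast ha
    rw [div_eq_div_iff (hm' y) ha']
    have : (n y * a) • x₀.1 = (b * m y) • x₀.1 := by
      rw [mul_comm, mul_smul, ← hmn, mul_comm, mul_smul, ← hab, smul_comm]
    exact_mod_cast smul_left_injective ℤ x₀.2.ne' this
  let f : H →+ ℚ := AddMonoidHom.mk' (fun y => (n y : ℚ) / m y) fun y z => by
    rw [key (a := m y * m z) (b := n y * m z + n z * m y) (mul_ne_zero (hm y) (hm z))]
    · have := hm' y
      have := hm' z
      push_cast
      field_simp
    · calc (m y * m z) • (y + z) = m z • (m y • y) + m y • (m z • z) := by module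
        _ = _ := by rw [hmn, hmn]; module
  refine ⟨f, fun y z hyz => ?_⟩
  rw [← sub_pos, ← map_sub]
  have hpos : 0 < z - y := sub_pos.mpr hyz
  generalize z - y = w at hpos
  show (0 : ℚ) < n w / m w
  have h1 := hmn w
  rcases lt_or_gt_of_ne (hm w) with h | h
  · have := zsmul_pos hpos (by omega : 0 < -m w)
    rw [neg_smul, h1, ← neg_smul, zsmul_pos_iff_left x₀.2] at this
    exact div_pos_of_neg_of_neg (by exact_mod_cast (by omega : n w < 0)) (by exact_mod_cast h)
  · have := zsmul_pos hpos h
    rw [h1, zsmul_pos_iff_left x₀.2] at this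
    exact div_pos (by exact_mod_cast this) (by exact_mod_cast h)

theorem isRankOne_of_ne_bot {K : AddSubgroup ℚ} (hK : K ≠ ⊥) : IsRankOne K := by
  obtain ⟨x, hxK, hx⟩ := K.bot_or_exists_ne_zero.resolve_left hK
  refine isRankOne_of_exists_zsmul_eq (⟨x, hxK⟩ : K) (by simpa using hx) fun y => ?_
  refine ⟨y.1.den * x.num, y.1.num * x.den, ?_, ?_⟩
  · simpa using hx
  · apply Subtype.ext
    simp only [AddSubgroup.coe_zsmul, zsmul_eq_mul]
    push_cast
    have h1 := Rat.mul_den_eq_num y.1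
    have h2 := Rat.mul_den_eq_num x
    rw [← h1, ← h2]
    ring

/-- A totally ordered group of rank one is isomorphic to a subgroup of `ℚ`. -/
theorem IsRankOne.exists_orderAddIso (hH : IsRankOne H) :
    ∃ K : AddSubgroup ℚ, K ≠ ⊥ ∧ Nonempty (H ≃+o K) := by
  obtain ⟨f, hf⟩ := hH.exists_orderAddMonoidHom
  obtain ⟨x, hx⟩ := hH.exists_ne_zero
  refine ⟨f.range, fun h => hx (hf.injective ?_), ⟨⟨AddMonoidHom.ofInjective hf.injective, ?_⟩⟩⟩
  · have : f x ∈ f.range := ⟨x, rfl⟩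
    rw [h, AddSubgroup.mem_bot] at this
    rw [this, map_zero]
  · intro a b
    exact hf.le_iff_le

/-- The multiple `c K` of a subgroup `K` of `ℚ`, as a subgroup of `ℝ`. -/
def scaledSubgroup (c : ℝ) (K : AddSubgroup ℚ) : AddSubgroup ℝ :=
  K.map ((AddMonoidHom.mulLeft c).comp (Rat.castHom ℝ).toAddMonoidHom)

theorem mem_scaledSubgroup {c : ℝ} {K : AddSubgroup ℚ} {x : ℝ} :
    x ∈ scaledSubgroup c K ↔ ∃ k ∈ K, c * k = x := Iff.rfl

theorem isRankOne_scaledSubgroup {c : ℝ} (hc : c ≠ 0) {K : AddSubgroup ℚ} (hK : K ≠ ⊥) :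
    IsRankOne (scaledSubgroup c K) := by
  have hinj : Function.Injective
      ((AddMonoidHom.mulLeft c).comp (Rat.castHom ℝ).toAddMonoidHom) := fun a b h => by
    simpa [hc] using h
  have e : K ≃+ scaledSubgroup c K := K.equivMapOfInjective _ hinj
  have := isRankOne_of_ne_bot hK
  unfold IsRankOne at *
  rw [← this]
  exact e.toIntLinearEquiv.rank_eq.symm

/-- Ordered groups have isomorphic positive cones, as sets with an action of `ℕ^×`. -/
def PosIso (H H' : Type) [AddCommGroup H] [LinearOrder H] [IsOrderedAddMonoid H]
    [AddCommGroup H'] [LinearOrder H'] [IsOrderedAddMonoid H'] : Prop :=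
  ∃ e : Pos H ≃ Pos H', ∀ (n : ℕ+) x, e (n • x) = n • e x

theorem PosIso.symm (h : PosIso H H') : PosIso H' H := by
  obtain ⟨e, he⟩ := h
  refine ⟨e.symm, fun n x => ?_⟩
  rw [e.symm_apply_eq, he, e.apply_symm_apply]

theorem PosIso.trans {H'' : Type} [AddCommGroup H''] [LinearOrder H''] [IsOrderedAddMonoid H'']
    (h : PosIso H H') (h' : PosIso H' H'') : PosIso H H'' := by
  obtain ⟨e, he⟩ := h
  obtain ⟨e', he'⟩ := h'
  exact ⟨e.trans e', fun n x => by simp [he, he']⟩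

theorem posIso_of_orderAddIso (f : H ≃+o H') : PosIso H H' :=
  ⟨f.toEquiv.subtypeEquiv fun a => by
      show 0 < a ↔ 0 < f a
      rw [← map_zero f]; exact (map_lt_map_iff f).symm,
    fun n x => Subtype.ext (by
      show f ((n : ℕ) • x.1) = (n : ℕ) • f x.1
      exact map_nsmul f _ _)⟩

/-- An equivariant map from the positive cone of a subgroup of `ℚ` is linear. -/
theorem exists_linear {K : AddSubgroup ℚ} (hK : K ≠ ⊥) (ℓ : Pos K → ℝ)
    (h : ∀ (n : ℕ+) x, ℓ (n • x) = (n : ℝ) * ℓ x) : ∃ c : ℝ, ∀ x, ℓ x = c * x.1.1 := by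
  have hflat := (isRankOne_of_ne_bot hK).isFlatRelation
  obtain ⟨x₀⟩ := hflat.nonempty
  have hx₀ : (x₀.1.1 : ℝ) ≠ 0 := by
    have : (0 : ℚ) < x₀.1.1 := x₀.2
    exact_mod_cast this.ne'
  refine ⟨ℓ x₀ / x₀.1.1, fun x => ?_⟩
  obtain ⟨z, m, n, hm, hn⟩ := hflat.directed x x₀
  rw [div_mul_eq_mul_div, eq_div_iff hx₀]
  rw [← hm, ← hn, h, h, Pos.coe_smul, Pos.coe_smul]
  simp only [AddSubgroup.coe_nsmul, nsmul_eq_mul]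
  push_cast
  ring

/-- Equivariance makes the bijection linear by commensurability. Its factor is the ratio of two
rational numbers, and surjectivity gives the converse membership; negative elements follow by sign.
-/
theorem exists_scaling {K K' : AddSubgroup ℚ} (hK : K ≠ ⊥) (e : Pos K ≃ Pos K')
    (he : ∀ (n : ℕ+) x, e (n • x) = n • e x) :
    ∃ c : ℚ, 0 < c ∧ (∀ x, (e x).1.1 = c * x.1.1) ∧ ∀ q, q ∈ K ↔ c * q ∈ K' := by
  obtain ⟨c', hc'⟩ := exists_linear hK (fun x => ((e x).1.1 : ℝ)) (fun n x => by
    rw [he, Pos.coe_smul]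
    simp)
  obtain ⟨x₀⟩ := (isRankOne_of_ne_bot hK).isFlatRelation.nonempty
  have hpos (x : Pos K) : (0 : ℚ) < x.1.1 := x.2
  have hpos' (x : Pos K') : (0 : ℚ) < x.1.1 := x.2
  let c : ℚ := (e x₀).1.1 / x₀.1.1
  have hcc : (c : ℝ) = c' := by
    have : (x₀.1.1 : ℝ) ≠ 0 := by exact_mod_cast (hpos x₀).ne'
    simp only [c]
    push_cast
    rw [hc', mul_div_cancel_right₀ _ this]
  have hc (x) : (e x).1.1 = c * x.1.1 := by
    have := hc' x
    rw [← hcc] at this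
    exact_mod_cast this
  have hc0 : 0 < c := div_pos (hpos' _) (hpos _)
  have key (q : ℚ) (hq : 0 < q) : q ∈ K ↔ c * q ∈ K' := by
    constructor
    · intro h
      have := (e ⟨⟨q, h⟩, hq⟩).1.2
      rwa [hc] at this
    · intro h
      obtain ⟨x, hx⟩ := e.surjective ⟨⟨c * q, h⟩, mul_pos hc0 hq⟩
      have h2 := hc x
      rw [hx] at h2
      have : q = x.1.1 := mul_left_cancel₀ hc0.ne' h2
      rw [this]
      exact x.1.2
  refine ⟨c, hc0, hc, fun q => ?_⟩
  rcases lt_trichotomy q 0 with hq | rfl | hq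
  · rw [← neg_mem_iff, ← neg_mem_iff (x := c * q), ← mul_neg]
    exact key _ (neg_pos.mpr hq)
  · simp [zero_mem]
  · exact key _ hq

/-- Proportional subgroups of `ℚ` are isomorphic as ordered groups. -/
theorem nonempty_orderAddIso_of_scaling {K K' : AddSubgroup ℚ} {c : ℚ} (hc : 0 < c)
    (h : ∀ q, q ∈ K ↔ c * q ∈ K') : Nonempty (K ≃+o K') := by
  refine ⟨⟨⟨⟨fun x => ⟨c * x.1, (h _).mp x.2⟩, fun y => ⟨c⁻¹ * y.1, (h _).mpr ?_⟩, ?_, ?_⟩, ?_⟩, ?_⟩⟩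
  · rw [mul_inv_cancel_left₀ hc.ne']
    exact y.2
  · intro x
    simp [hc.ne']
  · intro x
    simp [hc.ne']
  · intro x y
    simp [mul_add]
  · intro x y
    show c * x.1 ≤ c * y.1 ↔ x.1 ≤ y.1
    exact mul_le_mul_iff_right₀ hc

/-- The addition and the order are recovered from the action alone: after embedding both groups in
`ℚ`, an equivariant bijection of positive cones is multiplication by a positive rational. -/
theorem PosIso.nonempty_orderAddIso (hH : IsRankOne H) (hH' : IsRankOne H') (h : PosIso H H') :
    Nonempty (H ≃+o H') := by
  obtain ⟨K, hK, ⟨f⟩⟩ := hH.exists_orderAddIso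
  obtain ⟨K', hK', ⟨f'⟩⟩ := hH'.exists_orderAddIso
  obtain ⟨e, he⟩ := ((posIso_of_orderAddIso f).symm.trans h).trans (posIso_of_orderAddIso f')
  obtain ⟨c, hc, -, hcK⟩ := exists_scaling hK e he
  obtain ⟨g⟩ := nonempty_orderAddIso_of_scaling hc hcK
  exact ⟨(f.trans g).trans f'.symm⟩

end Pos
end

section

/-! ### Flat continuous functors on the site of intervals -/

/-- A functor on the category of intervals is flat and continuous if its category of elements is
cofiltered and it sends coverings to jointly surjective families. -/
structure IsFlatContinuous (F : Interval ⥤ Type) : Prop where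
  nonempty : ∃ V, Nonempty (F.obj V)
  directed : ∀ {V W} (x : F.obj V) (y : F.obj W),
    ∃ (U : Interval) (f : U ⟶ V) (g : U ⟶ W) (z : F.obj U), F.map f z = x ∧ F.map g z = y
  equalize : ∀ {U V : Interval} (f g : U ⟶ V) (x : F.obj U), F.map f x = F.map g x →
    ∃ (W : Interval) (h : W ⟶ U) (z : F.obj W), F.map h z = x ∧ h ≫ f = h ≫ g
  cover : ∀ {V : Interval} (x : F.obj V) (S : Sieve V), S ∈ Interval.topology V →
    ∃ (U : Interval) (f : U ⟶ V) (z : F.obj U), S f ∧ F.map f z = x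

instance preservesColimits_inverse {E : Type*} [Category E] (p : ToposPoint E) :
    Limits.PreservesColimitsOfSize.{0, 0} p.inverse := p.adj.leftAdjoint_preservesColimits

/-- The inclusion of a covering sieve is injective, and it is locally surjective because the
pullback of the sieve along any section is covering. Sheafification therefore inverts it. -/
theorem isIso_presheafToSheaf_functorInclusion {V : Interval} (S : Sieve V)
    (hS : S ∈ Interval.topology V) :
    IsIso ((presheafToSheaf Interval.topology Type).map S.functorInclusion) := by
  rw [← GrothendieckTopology.W_iff, GrothendieckTopology.W_iff_isLocallyBijective]
  refine ⟨⟨fun {X} x y h => ?_⟩, ⟨fun {X} f => ?_⟩⟩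
  · have : x = y := Subtype.ext h
    rw [this]
    convert Interval.topology.top_mem X.unop
    ext Y g
    simp [Presheaf.equalizerSieve]
  · refine Interval.topology.superset_covering ?_ (Interval.topology.pullback_stable f hS)
    intro Y g hg
    exact ⟨⟨g ≫ f, hg⟩, rfl⟩

theorem yonedaEquiv_symm_hom {C : Type} [SmallCategory C] {c d : C} (f : c ⟶ d) :
    (yonedaEquiv (F := yoneda.obj d)).symm f = yoneda.map f := by
  rw [Equiv.symm_apply_eq, yonedaEquiv_yoneda_map]

/-- Flatness comes from the exactness of sheafification followed by `p^*`. Continuity holds because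
this composite inverts the inclusion of a covering sieve, whose elements come from representables.
-/
theorem isFlatContinuous_fiber (p : ToposPoint HalfLineTopos) : IsFlatContinuous (fiber p) := by
  let G : (Intervalᵒᵖ ⥤ Type) ⥤ Type := presheafToSheaf Interval.topology Type ⋙ p.inverse
  have hcol : Limits.PreservesColimitsOfSize.{0, 0} (presheafToSheaf Interval.topology Type) :=
    (sheafificationAdjunction Interval.topology Type).leftAdjoint_preservesColimits
  have : Limits.PreservesColimitsOfSize.{0, 0} G := inferInstance
  have : Limits.PreservesFiniteLimits G := Limits.comp_preservesFiniteLimits _ _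
  refine ⟨exists_element G, fun {V W} x y => ?_, fun {U V} f g x h => ?_, fun {V} x S hS => ?_⟩
  · obtain ⟨e, s, t, z, h1, h2⟩ := exists_span G x y
    refine ⟨e, s, t, z, ?_, ?_⟩
    · rw [← h1, yonedaEquiv_symm_hom]
      rfl
    · rw [← h2, yonedaEquiv_symm_hom]
      rfl
  · obtain ⟨e, k, z, h1, h2⟩ := exists_equalizing G (P := yoneda.obj V) f g x (by
      rw [yonedaEquiv_symm_hom, yonedaEquiv_symm_hom]
      exact h)
    exact ⟨e, k, z, h1, h2⟩
  · have := isIso_presheafToSheaf_functorInclusion S hS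
    have hiso : IsIso (G.map S.functorInclusion) :=
      inferInstanceAs (IsIso (p.inverse.map _))
    obtain ⟨t, rfl⟩ := ((isIso_iff_bijective _).mp hiso).2 x
    obtain ⟨U, s, z, rfl⟩ := exists_representable G t
    refine ⟨U, s.1, z, s.2, ?_⟩
    rw [← Functor.map_comp_apply]
    have : yonedaEquiv.symm s ≫ S.functorInclusion = yoneda.map s.1 := by
      apply yonedaEquiv.injective
      rw [yonedaEquiv_comp, Equiv.apply_symm_apply, yonedaEquiv_yoneda_map]
      rfl
    rw [this]
    rfl

/-- Points with isomorphic functors on the site are isomorphic. -/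
theorem nonempty_inverse_iso_of_fiber_iso {p q : ToposPoint HalfLineTopos}
    (e : fiber p ≅ fiber q) : p ≈ q := by
  have hcol : Limits.PreservesColimitsOfSize.{0, 0} (presheafToSheaf Interval.topology Type) :=
    (sheafificationAdjunction Interval.topology Type).leftAdjoint_preservesColimits
  obtain ⟨E, -⟩ := exists_iso_of_iso_representables
    (G := presheafToSheaf Interval.topology Type ⋙ p.inverse)
    (G' := presheafToSheaf Interval.topology Type ⋙ q.inverse) e
  -- Every sheaf is the sheafification of its underlying presheaf, so `E` restricts to an
  -- isomorphism of the inverse images.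
  let c := asIso (sheafificationAdjunction Interval.topology Type).counit
  exact ⟨(Functor.leftUnitor _).symm ≪≫ Functor.isoWhiskerRight c.symm p.inverse ≪≫
    Functor.associator _ _ _ ≪≫
    Functor.isoWhiskerLeft (sheafToPresheaf Interval.topology Type) E ≪≫
    (Functor.associator _ _ _).symm ≪≫ Functor.isoWhiskerRight c q.inverse ≪≫
    Functor.leftUnitor _⟩

theorem nonempty_fiber_iso {p q : ToposPoint HalfLineTopos} (h : p ≈ q) :
    Nonempty (fiber p ≅ fiber q) := by
  obtain ⟨e⟩ := h
  exact ⟨Functor.isoWhiskerLeft _ (Functor.isoWhiskerLeft _ e)⟩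

/-- A flat continuous functor is the functor of a point. -/
theorem exists_point_of_isCofiltered (F : Interval ⥤ Type) [IsCofiltered F.Elements]
    (hF : ∀ {V : Interval} (S : Sieve V), S ∈ Interval.topology V → ∀ x : F.obj V,
      ∃ (U : Interval) (f : U ⟶ V) (_ : S f) (z : F.obj U), F.map f z = x) :
    ∃ p : ToposPoint HalfLineTopos, Nonempty (fiber p ≅ F) := by
  have : InitiallySmall.{0} F.Elements := initiallySmall_of_essentiallySmall _
  let Φ : GrothendieckTopology.Point.{0} Interval.topology :=
    { fiber := F
      jointly_surjective := fun S hS x => hF S hS x }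
  refine ⟨⟨Φ.sheafFiber, Φ.skyscraperSheafFunctor, Φ.skyscraperSheafAdjunction, inferInstance⟩,
    ⟨?_⟩⟩
  exact Functor.isoWhiskerLeft yoneda (Φ.presheafToSheafCompSheafFiberIso Type) ≪≫
    Functor.isoWhiskerRight shrinkYonedaIsoYoneda.symm _ ≪≫
    Φ.shrinkYonedaCompPresheafFiberIso

/-! ### Intervals -/

namespace Interval

/-- The interval `[0, a)`. -/
def below (a : ℝ≥0) : Interval where
  carrier := Set.Iio a
  isOpen := isOpen_Iio
  ordConnected := Set.ordConnected_Iio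
  isBounded := (Metric.isBounded_Icc 0 a).subset fun _ h => ⟨zero_le, le_of_lt h⟩

theorem mem_below {a x : ℝ≥0} : x ∈ below a ↔ x < a := Iff.rfl

theorem mem_restrict {n : ℕ+} {U V : Interval} {x : ℝ≥0} :
    x ∈ restrict n U V ↔ x ∈ U ∧ (n : ℝ≥0) * x ∈ V := Iff.rfl

theorem mem_restrict_one {U V : Interval} {x : ℝ≥0} :
    x ∈ restrict 1 U V ↔ x ∈ U ∧ x ∈ V := by
  rw [mem_restrict, PNat.one_coe, Nat.cast_one, one_mul]

theorem restrict_subset (n : ℕ+) (U V : Interval) : restrict n U V ⊆ U := fun _ h => h.1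

theorem exists_subset_below (V : Interval) : ∃ a, V ⊆ below a := by
  obtain ⟨M, hM⟩ := V.isBounded.bddAbove
  exact ⟨M + 1, fun x hx => (hM hx).trans_lt (lt_add_one M)⟩

/-- The morphism labelled by `n` from a nonempty interval `U` to `V`, if `n U ⊆ V`. -/
def homMk {U V : Interval} (n : ℕ+) (h : ∀ x ∈ U, (n : ℝ≥0) * x ∈ V) {y : ℝ≥0} (hy : y ∈ U) :
    U ⟶ V :=
  ⟨n, h, fun h' => absurd h' (Set.nonempty_iff_ne_empty.mp ⟨y, hy⟩)⟩

theorem mult_incl {U V : Interval} (h : U ⊆ V) : mult (incl h) = 1 := rfl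

/-- Distinct points of an interval have disjoint neighbourhoods. -/
theorem exists_disjoint (V : Interval) {a b : ℝ≥0} (ha : a ∈ V) (hb : b ∈ V) (hab : a ≠ b) :
    ∃ U W : Interval, U ⊆ V ∧ W ⊆ V ∧ a ∈ U ∧ b ∈ W ∧ ∀ x ∈ U, x ∉ W := by
  wlog h : a < b generalizing a b
  · obtain ⟨U, W, h1, h2, h3, h4, h5⟩ :=
      this hb ha hab.symm (lt_of_le_of_ne (not_lt.mp h) hab.symm)
    exact ⟨W, U, h2, h1, h4, h3, fun x hx hx' => h5 x hx' hx⟩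
  obtain ⟨c, hac, hcb⟩ := exists_between h
  refine ⟨⟨V.carrier ∩ Set.Iio c, V.isOpen.inter isOpen_Iio,
    V.ordConnected.inter Set.ordConnected_Iio, V.isBounded.subset Set.inter_subset_left⟩,
    ⟨V.carrier ∩ Set.Ioi c, V.isOpen.inter isOpen_Ioi,
    V.ordConnected.inter Set.ordConnected_Ioi, V.isBounded.subset Set.inter_subset_left⟩,
    fun x hx => hx.1, fun x hx => hx.1, ⟨ha, hac⟩, ⟨hb, hcb⟩, fun x hx hx' => ?_⟩
  exact lt_asymm (show x < c from hx.2) (show c < x from hx'.2)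

end Interval

open ScalingTopos.Interval

/-! ### Locations -/

theorem LocatedAt.map {F : Interval ⥤ Type} {V W : Interval} (f : V ⟶ W) {x : F.obj V} {l : ℝ≥0}
    (hl : LocatedAt F x l) : LocatedAt F (F.map f x) (mult f * l) := by
  refine ⟨mult_mem f hl.1, fun U hU hlU => ?_⟩
  -- The preimage of `U` under `f` is a neighbourhood of `l`, so `x` comes from it.
  obtain ⟨z, hz⟩ := hl.2 (restrict (mult f) V U) (restrict_subset _ _ _) ⟨hl.1, hlU⟩
  let k : restrict (mult f) V U ⟶ U := homMk (mult f) (fun x hx => hx.2) ⟨hl.1, hlU⟩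
  have hk : k ≫ incl hU = incl (restrict_subset _ _ _) ≫ f := hom_ext fun x hx => by
    rw [mult_comp _ _ hx, mult_comp _ _ hx, mult_incl, mult_incl, one_mul, mul_one]
    rfl
  exact ⟨F.map k z, by rw [← hz, ← Functor.map_comp_apply, ← Functor.map_comp_apply, hk]⟩

namespace IsFlatContinuous

variable {F : Interval ⥤ Type} (h : IsFlatContinuous F)
include h

/-- The empty sieve covers the empty interval, so continuity leaves no elements over it. Multipliers
of morphisms are therefore meaningful wherever `F` has elements. -/
theorem exists_mem {V : Interval} (x : F.obj V) : ∃ y, y ∈ V := by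
  by_contra! hV
  obtain ⟨_, _, _, hS, -⟩ := h.cover x ⊥ (fun y hy => absurd hy (hV y))
  exact hS

theorem mult_eq {U V : Interval} {f g : U ⟶ V} {x : F.obj U} (hx : F.map f x = F.map g x) :
    mult f = mult g := by
  obtain ⟨W, k, z, -, hk⟩ := h.equalize f g x hx
  obtain ⟨y, hy⟩ := h.exists_mem z
  have := congr_arg mult hk
  rw [mult_comp _ _ hy, mult_comp _ _ hy] at this
  exact mul_right_cancel this

/-- On a common refinement of `z` and `z'`, the two maps have the same multiplier `n`, because their
composites into `V` agree on an element. Hence the image of the refinement under `n` lies in both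
intervals. -/
theorem exists_inter {U U' V : Interval} (hU : U ⊆ V) (hU' : U' ⊆ V) {z : F.obj U} {z' : F.obj U'}
    (hz : F.map (incl hU) z = F.map (incl hU') z') :
    ∃ w : F.obj (restrict 1 U U'), F.map (incl (restrict_subset 1 U U')) w = z := by
  obtain ⟨W, f, g, w, rfl, rfl⟩ := h.directed z z'
  obtain ⟨y, hy⟩ := h.exists_mem w
  have hfg : mult f = mult g := by
    rw [← Functor.map_comp_apply, ← Functor.map_comp_apply] at hz
    have := h.mult_eq hz
    rwa [mult_comp _ _ hy, mult_comp _ _ hy, mult_incl, mult_incl, one_mul, one_mul] at this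
  let k : W ⟶ restrict 1 U U' := homMk (mult f) (fun x hx => mem_restrict_one.mpr
    ⟨mult_mem f hx, hfg ▸ mult_mem g hx⟩) hy
  have hk : k ≫ incl (restrict_subset 1 U U') = f := hom_ext fun x hx => by
    rw [mult_comp _ _ hx, mult_incl, one_mul]
    rfl
  exact ⟨F.map k w, by rw [← Functor.map_comp_apply, hk]⟩

/-- If `x` had no location, each point of `V` would have a neighbourhood from which `x` does not
come. These neighbourhoods cover `V`, against continuity. -/
theorem exists_locatedAt {V : Interval} (x : F.obj V) : ∃ l, LocatedAt F x l := by
  by_contra! hcon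
  let S : Sieve V :=
    { arrows := fun U f => ∀ z, F.map f z ≠ x
      downward_closed := by
        intro U W f hf g z hz
        rw [Functor.map_comp_apply] at hz
        exact hf _ hz }
  have hS : S ∈ Interval.topology V := by
    intro l hl
    have := hcon l
    unfold LocatedAt at this
    push Not at this
    obtain ⟨U, hU, hlU, hz⟩ := this hl
    exact ⟨U, hU, hlU, hz⟩
  obtain ⟨U, f, z, hf, hz⟩ := h.cover x S hS
  exact hf z hz

/-- Two locations would have disjoint neighbourhoods, and `x` would come from their empty
intersection. -/
theorem locatedAt_unique {V : Interval} {x : F.obj V} {l l' : ℝ≥0} (hl : LocatedAt F x l)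
    (hl' : LocatedAt F x l') : l = l' := by
  by_contra hne
  obtain ⟨U, W, hU, hW, h1, h2, h3⟩ := V.exists_disjoint hl.1 hl'.1 hne
  obtain ⟨z, hz⟩ := hl.2 U hU h1
  obtain ⟨z', hz'⟩ := hl'.2 W hW h2
  obtain ⟨w, -⟩ := h.exists_inter hU hW (hz.trans hz'.symm)
  obtain ⟨y, hy⟩ := h.exists_mem w
  exact h3 y (mem_restrict_one.mp hy).1 (mem_restrict_one.mp hy).2

/-- The relation `x = m z` between elements of a flat continuous functor. -/
theorem isFlatRelation : IsFlatRelation (S := Σ V, F.obj V)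
    fun m z x => ∃ f : z.1 ⟶ x.1, mult f = m ∧ F.map f z.2 = x.2 where
  nonempty := by
    obtain ⟨V, ⟨x⟩⟩ := h.nonempty
    exact ⟨⟨V, x⟩⟩
  directed x y := by
    obtain ⟨U, f, g, z, hf, hg⟩ := h.directed x.2 y.2
    exact ⟨⟨U, z⟩, mult f, mult g, ⟨f, rfl, hf⟩, ⟨g, rfl, hg⟩⟩
  free := by
    rintro _ _ z x ⟨f, rfl, hf⟩ ⟨g, rfl, hg⟩
    exact h.mult_eq (hf.trans hg.symm)
  comp := by
    rintro _ _ w z x ⟨f, rfl, hf⟩ ⟨g, rfl, hg⟩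
    obtain ⟨y, hy⟩ := h.exists_mem w.2
    exact ⟨g ≫ f, mult_comp g f hy, by rw [Functor.map_comp_apply, hg, hf]⟩
  exists_multiple := by
    rintro n ⟨V, z⟩
    obtain ⟨y, hy⟩ := h.exists_mem z
    obtain ⟨a, ha⟩ := V.exists_subset_below
    -- Any bounded interval containing `n V` would do as a target.
    let f : V ⟶ below (n * a) := homMk n (fun x hx =>
      mul_lt_mul_of_pos_left (show x < a from ha hx) (by simp)) hy
    exact ⟨⟨_, F.map f z⟩, f, rfl, rfl⟩

end IsFlatContinuous

/-! ### The functor of an equivariant map to the half-line -/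

section OverFunctor

variable {H H' : Type} [AddCommGroup H] [LinearOrder H] [IsOrderedAddMonoid H]
  [AddCommGroup H'] [LinearOrder H'] [IsOrderedAddMonoid H']

/-- An `ℕ^×`-equivariant map `ℓ : H_+ → [0,∞)`. -/
structure PosMap (H : Type) [AddCommGroup H] [LinearOrder H] [IsOrderedAddMonoid H] where
  toFun : Pos H → ℝ≥0
  map_smul : ∀ (n : ℕ+) x, toFun (n • x) = n * toFun x

/-- The functor `V ↦ ℓ⁻¹(V)` of an equivariant map `ℓ : H_+ → [0,∞)`. -/
def overFunctor (ℓ : PosMap H) : Interval ⥤ Type where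
  obj V := {x : Pos H // ℓ.toFun x ∈ V}
  map f := TypeCat.ofHom fun x => ⟨mult f • x.1, by
    rw [ℓ.map_smul]
    exact mult_mem f x.2⟩
  map_id V := by
    ext x
    simp [mult_id, Pos.coe_smul]
  map_comp f g := by
    ext x
    simp [mult_comp f g x.2, Pos.mul_smul]

variable {ℓ : PosMap H} {ℓ' : PosMap H'} {U V : Interval}

/-- The element of `H_+` underlying an element of `ℓ⁻¹(V)`. -/
def overVal (x : (overFunctor ℓ).obj V) : Pos H := x.1

/-- The element of `ℓ⁻¹(V)` given by an element of `H_+`. -/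
def overMk (x : Pos H) (hx : ℓ.toFun x ∈ V) : (overFunctor ℓ).obj V := ⟨x, hx⟩

theorem overVal_mem (x : (overFunctor ℓ).obj V) : ℓ.toFun (overVal x) ∈ V := x.2

theorem overVal_mk (x : Pos H) (hx : ℓ.toFun x ∈ V) : overVal (overMk x hx) = x := rfl

theorem overVal_injective {x y : (overFunctor ℓ).obj V} (h : overVal x = overVal y) : x = y :=
  Subtype.ext h

theorem overVal_map (f : U ⟶ V) (x : (overFunctor ℓ).obj U) :
    overVal ((overFunctor ℓ).map f x) = mult f • overVal x := rfl

theorem Pos.one_smul (x : Pos H) : (1 : ℕ+) • x = x := Subtype.ext (by simp [Pos.coe_smul])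

theorem overVal_incl (h : U ⊆ V) (x : (overFunctor ℓ).obj U) :
    overVal ((overFunctor ℓ).map (incl h) x) = overVal x := by
  rw [overVal_map, mult_incl, Pos.one_smul]

theorem locatedAt_overFunctor_iff (x : (overFunctor ℓ).obj V) (l : ℝ≥0) :
    LocatedAt (overFunctor ℓ) x l ↔ l = ℓ.toFun (overVal x) := by
  constructor
  · rintro ⟨hl, h⟩
    by_contra hne
    obtain ⟨U, W, hU, hW, h1, h2, h3⟩ := V.exists_disjoint hl (overVal_mem x) hne
    obtain ⟨z, rfl⟩ := h U hU h1
    rw [overVal_incl] at h2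
    exact h3 _ (overVal_mem z) h2
  · rintro rfl
    refine ⟨overVal_mem x, fun U hU hx => ⟨overMk (overVal x) hx, overVal_injective ?_⟩⟩
    rw [overVal_incl, overVal_mk]

/-- The category of elements is cofiltered because positive elements have common divisors and
multipliers are unique. Continuity is immediate, since `ℓ x` lies in some member of any cover. -/
theorem exists_point_overFunctor (hH : IsRankOne H) (ℓ : PosMap H) :
    ∃ p : ToposPoint HalfLineTopos, Nonempty (fiber p ≅ overFunctor ℓ) := by
  have : IsCofiltered (overFunctor ℓ).Elements :=
    { nonempty := by
        obtain ⟨x⟩ := hH.isFlatRelation.nonempty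
        exact ⟨⟨below (ℓ.toFun x + 1), ⟨x, lt_add_one (ℓ.toFun x)⟩⟩⟩
      cone_objs := by
        rintro ⟨V, x⟩ ⟨W, y⟩
        obtain ⟨z, m, n, hm, hn⟩ := hH.exists_common (overVal x) (overVal y)
        have hx : (m : ℝ≥0) * ℓ.toFun z ∈ V := by
          rw [← ℓ.map_smul, hm]
          exact x.2
        have hy : (n : ℝ≥0) * ℓ.toFun z ∈ W := by
          rw [← ℓ.map_smul, hn]
          exact y.2
        -- The common refinement is the set of points sent to `V` by `m` and to `W` by `n`, cut out
        -- inside an auxiliary bounded neighbourhood of `ℓ z`.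
        have hz : ℓ.toFun z ∈ restrict n (restrict m (below (ℓ.toFun z + 1)) V) W :=
          ⟨⟨lt_add_one (ℓ.toFun z), hx⟩, hy⟩
        exact ⟨⟨restrict n (restrict m (below (ℓ.toFun z + 1)) V) W, ⟨z, hz⟩⟩,
          ⟨homMk m (fun t ht => ht.1.2) hz, Subtype.ext hm⟩,
          ⟨homMk n (fun t ht => ht.2) hz, Subtype.ext hn⟩, trivial⟩
      cone_maps := by
        rintro ⟨V, x⟩ ⟨W, y⟩ ⟨f, hf⟩ ⟨g, hg⟩
        have h := congr_arg overVal (hf.trans hg.symm)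
        have h' : f = g := hom_ext fun _ _ => Pos.smul_left_injective (overVal x) h
        subst h'
        exact ⟨_, 𝟙 _, rfl⟩ }
  refine exists_point_of_isCofiltered _ fun {V} S hS x => ?_
  obtain ⟨U, hU, hxU, hSU⟩ := hS _ (overVal_mem x)
  refine ⟨U, incl hU, hSU, overMk (overVal x) hxU, overVal_injective ?_⟩
  rw [overVal_incl, overVal_mk]

/-- A morphism of functors is given by a map of positive cones. -/
theorem exists_app_eq (E : overFunctor ℓ ⟶ overFunctor ℓ') :
    ∃ e : Pos H → Pos H', ∀ V (x : (overFunctor ℓ).obj V),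
      overVal (E.app V x) = e (overVal x) := by
  have mem (x : Pos H) : ℓ.toFun x ∈ below (ℓ.toFun x + 1) := lt_add_one (ℓ.toFun x)
  -- The interval `[0, ℓ x + 1)` is an arbitrary choice: naturality for the inclusions of an
  -- intersection shows that the result is the same over every interval containing `ℓ x`.
  refine ⟨fun x => overVal (E.app _ (overMk x (mem x))), fun V x => ?_⟩
  have key : ∀ {U W : Interval} (_ : U ⊆ W) (y : (overFunctor ℓ).obj U)
      (z : (overFunctor ℓ).obj W), overVal y = overVal z →
      overVal (E.app U y) = overVal (E.app W z) := by
    intro U W hUW y z hyz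
    have : (overFunctor ℓ).map (incl hUW) y = z := overVal_injective (by
      rw [overVal_incl, hyz])
    rw [← this, NatTrans.naturality_apply, overVal_incl]
  have hx : ℓ.toFun (overVal x) ∈ restrict 1 V (below (ℓ.toFun (overVal x) + 1)) :=
    mem_restrict_one.mpr ⟨overVal_mem x, mem _⟩
  rw [← key (restrict_subset 1 V _) (overMk (overVal x) hx) x rfl]
  exact key (fun t ht => (mem_restrict_one.mp ht).2) _ _ rfl

/-- Isomorphisms of functors come from isomorphisms of positive cones over the half-line. -/
theorem nonempty_overFunctor_iso_iff :
    Nonempty (overFunctor ℓ ≅ overFunctor ℓ') ↔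
      ∃ e : Pos H ≃ Pos H', (∀ (n : ℕ+) x, e (n • x) = n • e x) ∧
        ∀ x, ℓ'.toFun (e x) = ℓ.toFun x := by
  constructor
  · rintro ⟨E⟩
    obtain ⟨e, he⟩ := exists_app_eq E.hom
    obtain ⟨e', he'⟩ := exists_app_eq E.inv
    have mem (x : Pos H) : ℓ.toFun x ∈ below (ℓ.toFun x + 1) := lt_add_one (ℓ.toFun x)
    have mem' (x : Pos H') : ℓ'.toFun x ∈ below (ℓ'.toFun x + 1) := lt_add_one (ℓ'.toFun x)
    have h1 (x) : e' (e x) = x := by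
      have := congr_arg overVal (E.hom_inv_id_app_apply _ (overMk x (mem x)))
      rwa [he', he, overVal_mk] at this
    have h2 (x) : e (e' x) = x := by
      have := congr_arg overVal (E.inv_hom_id_app_apply _ (overMk x (mem' x)))
      rwa [he, he', overVal_mk] at this
    refine ⟨⟨e, e', h1, h2⟩, fun n x => ?_, fun x => ?_⟩
    · let f : below (ℓ.toFun x + 1) ⟶ below (n * (ℓ.toFun x + 1)) := homMk n (fun t ht =>
        mul_lt_mul_of_pos_left (mem_below.mp ht) (by simp)) (mem x)
      have := congr_arg overVal (NatTrans.naturality_apply E.hom f (overMk x (mem x)))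
      rw [overVal_map, he, he, overVal_map] at this
      exact this
    -- A natural transformation preserves locations, and the location of an element of `ℓ'⁻¹(V)` is
    -- its value under `ℓ'`.
    · have h1 : LocatedAt (overFunctor ℓ') (E.hom.app _ (overMk x (mem x))) (ℓ.toFun x) := by
        refine ⟨mem x, fun U hU hx => ⟨E.hom.app U (overMk x hx), ?_⟩⟩
        rw [← NatTrans.naturality_apply]
        congr 1
        apply overVal_injective
        rw [overVal_incl]
        rfl
      rw [locatedAt_overFunctor_iff, he] at h1
      exact h1.symm
  · rintro ⟨e, he, hℓ⟩
    refine ⟨NatIso.ofComponents (fun V => Equiv.toIso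
      (X := (overFunctor ℓ).obj V) (Y := (overFunctor ℓ').obj V)
      (e.subtypeEquiv fun x => by rw [hℓ])) ?_⟩
    intro U V f
    ext x
    exact overVal_injective (he (mult f) (overVal x))

end OverFunctor
end

section
open ScalingTopos.Interval

/-! ### Equivariant maps to the half-line up to isomorphism -/

namespace PosMap

variable {H H' H'' : Type} [AddCommGroup H] [LinearOrder H] [IsOrderedAddMonoid H]
  [AddCommGroup H'] [LinearOrder H'] [IsOrderedAddMonoid H']
  [AddCommGroup H''] [LinearOrder H''] [IsOrderedAddMonoid H'']

/-- Isomorphism of positive cones over the half-line. -/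
def IsIsoTo (ℓ : PosMap H) (ℓ' : PosMap H') : Prop :=
  ∃ e : Pos H ≃ Pos H', (∀ (n : ℕ+) x, e (n • x) = n • e x) ∧ ∀ x, ℓ'.toFun (e x) = ℓ.toFun x

variable {ℓ : PosMap H} {ℓ' : PosMap H'} {ℓ'' : PosMap H''}

theorem IsIsoTo.symm (h : ℓ.IsIsoTo ℓ') : ℓ'.IsIsoTo ℓ := by
  obtain ⟨e, he, hℓ⟩ := h
  refine ⟨e.symm, fun n x => ?_, fun x => ?_⟩
  · rw [e.symm_apply_eq, he, e.apply_symm_apply]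
  · rw [← hℓ, e.apply_symm_apply]

theorem IsIsoTo.posIso (h : ℓ.IsIsoTo ℓ') : PosIso H H' := by
  obtain ⟨e, he, -⟩ := h
  exact ⟨e, he⟩

variable (H) in
/-- The zero map on `H_+`. -/
def zero : PosMap H := ⟨fun _ => 0, fun _ _ => (mul_zero _).symm⟩

/-- The inclusion of the positive part of a subgroup of `ℝ` in the half-line. -/
def ofSubgroup (H : AddSubgroup ℝ) : PosMap H where
  toFun x := ⟨x.1.1, le_of_lt x.2⟩
  map_smul n x := NNReal.eq (by
    show (n : ℕ) • (x.1.1 : ℝ) = ((n : ℕ) : ℝ) * x.1.1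
    exact nsmul_eq_mul _ _)

theorem ofSubgroup_toFun {H : AddSubgroup ℝ} (x : Pos H) :
    ((ofSubgroup H).toFun x : ℝ) = x.1.1 := rfl

theorem ofSubgroup_pos {H : AddSubgroup ℝ} (x : Pos H) : 0 < (ofSubgroup H).toFun x := x.2

/-- The map `k ↦ c k` on the positive part of a subgroup `K` of `ℚ`. -/
def linear (K : AddSubgroup ℚ) (c : ℝ≥0) : PosMap K where
  toFun x := c * Real.toNNReal (x.1.1 : ℝ)
  map_smul n x := NNReal.eq (by
    rw [Pos.coe_smul, AddSubgroup.coe_nsmul, nsmul_eq_mul, Rat.cast_mul, Rat.cast_natCast,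
      Real.toNNReal_mul (Nat.cast_nonneg _), Real.toNNReal_natCast]
    push_cast
    ring)

theorem linear_toFun {K : AddSubgroup ℚ} {c : ℝ≥0} (x : Pos K) :
    ((linear K c).toFun x : ℝ) = c * (x.1.1 : ℝ) := by
  have hx : (0 : ℝ) ≤ (x.1.1 : ℝ) := by exact_mod_cast (show (0 : ℚ) < x.1.1 from x.2).le
  show ((c * Real.toNNReal (x.1.1 : ℝ) : ℝ≥0) : ℝ) = _
  rw [NNReal.coe_mul, Real.coe_toNNReal _ hx]

/-- An equivariant bijection of positive cones is multiplication by a positive rational, so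
rescaling is the only freedom in the normal form `(K, c)`. -/
theorem linear_isIsoTo_iff {K K' : AddSubgroup ℚ} (hK : K ≠ ⊥) {c c' : ℝ≥0} :
    (linear K c).IsIsoTo (linear K' c') ↔
      ∃ q : ℚ, 0 < q ∧ (∀ k, k ∈ K ↔ q * k ∈ K') ∧ (c : ℝ) = c' * q := by
  constructor
  · rintro ⟨e, he, hℓ⟩
    obtain ⟨q, hq, hqe, hqK⟩ := exists_scaling hK e he
    obtain ⟨x⟩ := (isRankOne_of_ne_bot hK).isFlatRelation.nonempty
    refine ⟨q, hq, hqK, ?_⟩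
    have h1 := congr_arg NNReal.toReal (hℓ x)
    rw [linear_toFun, linear_toFun, hqe] at h1
    have hx : (0 : ℚ) < x.1.1 := x.2
    have hx' : (x.1.1 : ℝ) ≠ 0 := by exact_mod_cast hx.ne'
    apply mul_right_cancel₀ hx'
    rw [← h1]
    push_cast
    ring
  · rintro ⟨q, hq, hqK, hc⟩
    refine ⟨⟨fun x => ⟨⟨q * x.1.1, (hqK _).mp x.1.2⟩, mul_pos hq (show (0 : ℚ) < x.1.1 from x.2)⟩,
      fun y => ⟨⟨q⁻¹ * y.1.1, (hqK _).mpr ?_⟩, mul_pos (inv_pos.mpr hq)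
        (show (0 : ℚ) < y.1.1 from y.2)⟩, fun x => ?_, fun y => ?_⟩, fun n x => ?_, fun x => ?_⟩
    · rw [mul_inv_cancel_left₀ hq.ne']
      exact y.1.2
    · exact Subtype.ext (Subtype.ext (inv_mul_cancel_left₀ hq.ne' _))
    · exact Subtype.ext (Subtype.ext (mul_inv_cancel_left₀ hq.ne' _))
    · refine Subtype.ext (Subtype.ext ?_)
      show q * ((n : ℕ) • x.1.1) = (n : ℕ) • (q * x.1.1)
      rw [nsmul_eq_mul, nsmul_eq_mul]
      ring
    · apply NNReal.eq
      rw [linear_toFun, linear_toFun, hc]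
      show (c' : ℝ) * ((q * x.1.1 : ℚ) : ℝ) = _
      push_cast
      ring

theorem linear_isIsoTo_ofSubgroup {K : AddSubgroup ℚ} {c : ℝ≥0} (hc : c ≠ 0) :
    (linear K c).IsIsoTo (ofSubgroup (scaledSubgroup c K)) := by
  have hc' : (0 : ℝ) < c := by positivity
  have hpos {k : ℚ} : 0 < (c : ℝ) * k ↔ 0 < k := by
    rw [mul_pos_iff_of_pos_left hc', Rat.cast_pos]
  let f : Pos K → Pos (scaledSubgroup c K) := fun x =>
    ⟨⟨c * (x.1.1 : ℝ), mem_scaledSubgroup.mpr ⟨x.1.1, x.1.2, rfl⟩⟩, hpos.mpr x.2⟩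
  have hf : Function.Bijective f := by
    constructor
    · intro x y hxy
      have h1 : (c : ℝ) * (x.1.1 : ℝ) = c * (y.1.1 : ℝ) :=
        congr_arg (fun z : Pos (scaledSubgroup c K) => (z.1.1 : ℝ)) hxy
      exact Subtype.ext (Subtype.ext (by exact_mod_cast mul_left_cancel₀ hc'.ne' h1))
    · rintro ⟨⟨y, hy⟩, hy0⟩
      obtain ⟨k, hk, rfl⟩ := mem_scaledSubgroup.mp hy
      exact ⟨⟨⟨k, hk⟩, hpos.mp hy0⟩, rfl⟩
  refine ⟨Equiv.ofBijective f hf, fun n x => ?_, fun x => NNReal.eq (linear_toFun x).symm⟩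
  refine Subtype.ext (Subtype.ext ?_)
  show (c : ℝ) * (((n : ℕ) • x.1.1 : ℚ) : ℝ) = (n : ℕ) • ((c : ℝ) * (x.1.1 : ℝ))
  rw [nsmul_eq_mul, nsmul_eq_mul]
  push_cast
  ring

theorem zero_isIsoTo_zero (h : PosIso H H') : (zero H).IsIsoTo (zero H') := by
  obtain ⟨e, he⟩ := h
  exact ⟨e, he, fun _ => rfl⟩

theorem linear_zero (K : AddSubgroup ℚ) : linear K 0 = zero K := by
  unfold linear zero
  congr
  ext x
  rw [zero_mul]

theorem not_ofSubgroup_isIsoTo_zero {K : AddSubgroup ℝ} (hK : IsRankOne K) :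
    ¬ (ofSubgroup K).IsIsoTo (zero H) := by
  rintro ⟨e, -, hℓ⟩
  obtain ⟨x⟩ := hK.isFlatRelation.nonempty
  exact (ofSubgroup_pos x).ne (hℓ x)

/-- An isomorphism over the half-line preserves the real values of the elements, so the two
subgroups have the same positive elements. -/
theorem eq_of_ofSubgroup_isIsoTo {K K' : AddSubgroup ℝ}
    (h : (ofSubgroup K).IsIsoTo (ofSubgroup K')) : K = K' := by
  have key {K K' : AddSubgroup ℝ} (h : (ofSubgroup K).IsIsoTo (ofSubgroup K')) : K ≤ K' := by
    obtain ⟨e, -, hℓ⟩ := h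
    have hpos : ∀ x ∈ K, 0 < x → x ∈ K' := by
      intro x hx h0
      have h1 := congr_arg NNReal.toReal (hℓ ⟨⟨x, hx⟩, h0⟩)
      rw [ofSubgroup_toFun, ofSubgroup_toFun] at h1
      have h2 := (e ⟨⟨x, hx⟩, h0⟩).1.2
      rwa [h1] at h2
    intro x hx
    rcases lt_trichotomy x 0 with h0 | rfl | h0
    · rw [← neg_mem_iff]
      exact hpos _ (neg_mem hx) (neg_pos.mpr h0)
    · exact zero_mem _
    · exact hpos x hx h0
  exact le_antisymm (key h) (key h.symm)

end PosMap

/-! ### The functors of the points -/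

section Functors

variable {H H' : Type} [AddCommGroup H] [LinearOrder H] [IsOrderedAddMonoid H]
  [AddCommGroup H'] [LinearOrder H'] [IsOrderedAddMonoid H']

theorem nonempty_subgroupFunctor_iso (H : AddSubgroup ℝ) :
    Nonempty (subgroupFunctor H ≅ overFunctor (PosMap.ofSubgroup H)) := by
  refine ⟨NatIso.ofComponents (fun V => Equiv.toIso
    (X := (subgroupFunctor H).obj V) (Y := (overFunctor (PosMap.ofSubgroup H)).obj V)
    ⟨fun x => overMk ⟨⟨x.1, x.2.2.1⟩, x.2.2.2⟩ x.2.1,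
      fun y => ⟨(PosMap.ofSubgroup H).toFun (overVal y), overVal_mem y, (overVal y).1.2,
        PosMap.ofSubgroup_pos _⟩, fun x => rfl, fun y => rfl⟩) ?_⟩
  intro U V f
  ext x
  refine overVal_injective (Subtype.ext (Subtype.ext ?_))
  show ((mult f : ℝ≥0) * x.1 : ℝ) = (mult f : ℕ) • (x.1 : ℝ)
  simp

theorem nonempty_orderedGroupFunctor_iso :
    Nonempty (orderedGroupFunctor H ≅ overFunctor (PosMap.zero H)) := by
  refine ⟨NatIso.ofComponents (fun V => Equiv.toIso
    (X := (orderedGroupFunctor H).obj V) (Y := (overFunctor (PosMap.zero H)).obj V)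
    ⟨fun x => overMk ⟨x.1, x.2.1⟩ x.2.2,
      fun y => ⟨(overVal y).1, (overVal y).2, overVal_mem y⟩, fun x => rfl, fun y => rfl⟩) ?_⟩
  intro U V f
  ext x
  rfl

/-- The functor of the point `p` is the functor of `ℓ`. -/
def IsOver (p : ToposPoint HalfLineTopos) (ℓ : PosMap H) : Prop :=
  Nonempty (fiber p ≅ overFunctor ℓ)

variable {p q : ToposPoint HalfLineTopos} {ℓ : PosMap H} {ℓ' : PosMap H'}

theorem isOfSubgroup_iff {H : AddSubgroup ℝ} :
    IsOfSubgroup p H ↔ IsOver p (PosMap.ofSubgroup H) := by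
  obtain ⟨e⟩ := nonempty_subgroupFunctor_iso H
  exact ⟨fun ⟨f⟩ => ⟨f ≪≫ e⟩, fun ⟨f⟩ => ⟨f ≪≫ e.symm⟩⟩

theorem isOfOrderedGroup_iff : IsOfOrderedGroup p H ↔ IsOver p (PosMap.zero H) := by
  obtain ⟨e⟩ := nonempty_orderedGroupFunctor_iso (H := H)
  exact ⟨fun ⟨f⟩ => ⟨f ≪≫ e⟩, fun ⟨f⟩ => ⟨f ≪≫ e.symm⟩⟩

theorem IsOver.equiv_iff (hp : IsOver p ℓ) (hq : IsOver q ℓ') : p ≈ q ↔ ℓ.IsIsoTo ℓ' := by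
  obtain ⟨e⟩ := hp
  obtain ⟨f⟩ := hq
  constructor
  · intro h
    obtain ⟨g⟩ := nonempty_fiber_iso h
    exact nonempty_overFunctor_iso_iff.mp ⟨e.symm ≪≫ g ≪≫ f⟩
  · intro h
    obtain ⟨g⟩ := nonempty_overFunctor_iso_iff.mpr h
    exact nonempty_inverse_iso_of_fiber_iso (e ≪≫ g ≪≫ f.symm)

theorem IsOver.congr (hp : IsOver p ℓ) (h : ℓ.IsIsoTo ℓ') : IsOver p ℓ' := by
  obtain ⟨e⟩ := hp
  obtain ⟨g⟩ := nonempty_overFunctor_iso_iff.mpr h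
  exact ⟨e ≪≫ g⟩

theorem IsOver.isIsoTo (hp : IsOver p ℓ) (hp' : IsOver p ℓ') : ℓ.IsIsoTo ℓ' :=
  (hp.equiv_iff hp').mp (Setoid.refl p)

theorem LocatedAt.congr {F F' : Interval ⥤ Type} (e : F ≅ F') {V : Interval} {x : F.obj V}
    {l : ℝ≥0} (h : LocatedAt F x l) : LocatedAt F' (e.hom.app V x) l := by
  refine ⟨h.1, fun U hU hl => ?_⟩
  obtain ⟨z, rfl⟩ := h.2 U hU hl
  exact ⟨e.hom.app U z, (NatTrans.naturality_apply e.hom _ _).symm⟩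

/-- Locations are invariant under isomorphism of functors, and over `ℓ` they are the values of `ℓ`.
-/
theorem IsOver.support_eq (hp : IsOver p ℓ) : support p = Set.range ℓ.toFun := by
  obtain ⟨e⟩ := hp
  ext l
  constructor
  · rintro ⟨V, x, hx⟩
    have := hx.congr e
    rw [locatedAt_overFunctor_iff] at this
    exact ⟨_, this.symm⟩
  · rintro ⟨x, rfl⟩
    have hx : LocatedAt (overFunctor ℓ)
        (overMk (V := below (ℓ.toFun x + 1)) x (lt_add_one (ℓ.toFun x))) (ℓ.toFun x) := by
      rw [locatedAt_overFunctor_iff]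
      rfl
    exact ⟨_, _, hx.congr e.symm⟩

/-- Normal form of a flat continuous functor. -/
theorem IsFlatContinuous.exists_iso_linear {F : Interval ⥤ Type} (h : IsFlatContinuous F) :
    ∃ (K : AddSubgroup ℚ) (c : ℝ≥0), K ≠ ⊥ ∧ Nonempty (F ≅ overFunctor (PosMap.linear K c)) := by
  obtain ⟨φ, K, hK, hpos, hmul, hmem, hsurj, hinj⟩ := h.isFlatRelation.exists_degree
  choose loc hloc using fun x : (Σ V, F.obj V) => h.exists_locatedAt x.2
  have hlocmul {V W : Interval} (f : V ⟶ W) (x : F.obj V) :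
      loc ⟨W, F.map f x⟩ = mult f * loc ⟨V, x⟩ :=
    h.locatedAt_unique (hloc _) ((hloc ⟨V, x⟩).map f)
  have hφmul {V W : Interval} (f : V ⟶ W) (x : F.obj V) :
      φ ⟨W, F.map f x⟩ = mult f * φ ⟨V, x⟩ := hmul _ ⟨V, x⟩ ⟨W, F.map f x⟩ ⟨f, rfl, rfl⟩
  obtain ⟨x₀⟩ := h.isFlatRelation.nonempty
  have hφ₀ : (φ x₀ : ℝ) ≠ 0 := by exact_mod_cast (hpos x₀).ne'
  -- Location and degree are both multiplied by `n` under a morphism labelled by `n`, so by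
  -- commensurability they are proportional.
  let c : ℝ≥0 := loc x₀ / ⟨(φ x₀ : ℝ), by exact_mod_cast (hpos x₀).le⟩
  have hc (x) : (loc x : ℝ) = c * (φ x : ℝ) := by
    have hc' : (c : ℝ) = loc x₀ / (φ x₀ : ℝ) := NNReal.coe_div _ _
    obtain ⟨V, x⟩ := x
    obtain ⟨V₀, x₀⟩ := x₀
    obtain ⟨U, f, g, z, rfl, rfl⟩ := h.directed x x₀
    rw [hc', div_mul_eq_mul_div, eq_div_iff hφ₀, hlocmul, hlocmul, hφmul, hφmul]
    push_cast
    ring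
  have hcφ (x) : loc x = (PosMap.linear K c).toFun ⟨⟨φ x, hmem x⟩, hpos x⟩ :=
    NNReal.eq ((hc x).trans (PosMap.linear_toFun (K := K) (c := c) ⟨⟨φ x, hmem x⟩, hpos x⟩).symm)
  refine ⟨K, c, hK, ⟨NatIso.ofComponents (fun V => Equiv.toIso
    (X := F.obj V) (Y := (overFunctor (PosMap.linear K c)).obj V) (Equiv.ofBijective
      (fun x => overMk ⟨⟨φ ⟨V, x⟩, hmem _⟩, hpos _⟩ (by rw [← hcφ]; exact (hloc ⟨V, x⟩).1))
      ⟨fun x y hxy => ?_, fun y => ?_⟩)) ?_⟩⟩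
  -- Elements of `F(V)` of equal degree are images of one element by morphisms with the same label,
  -- hence by the same morphism.
  · have h1 : φ ⟨V, x⟩ = φ ⟨V, y⟩ :=
      congr_arg (fun z : (overFunctor (PosMap.linear K c)).obj V => ((overVal z).1 : ℚ)) hxy
    obtain ⟨⟨U, z⟩, m, ⟨f, hf, hfx⟩, g, hg, hgy⟩ := hinj _ _ h1
    have : f = g := hom_ext fun _ _ => hf.trans hg.symm
    subst this
    exact hfx.symm.trans hgy
  -- An element of the required degree exists over some `U`. Its location lies in `V`, so it comes
  -- from `U ∩ V` and can be pushed to `V`.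
  · obtain ⟨⟨U, x⟩, hx⟩ := hsurj (overVal y).1.1 (overVal y).1.2 (overVal y).2
    have hl : loc ⟨U, x⟩ = (PosMap.linear K c).toFun (overVal y) := by
      rw [hcφ]
      congr
    have hlV : loc ⟨U, x⟩ ∈ V := by
      rw [hl]
      exact overVal_mem y
    obtain ⟨z, hz⟩ := (hloc ⟨U, x⟩).2 (restrict 1 U V) (restrict_subset _ _ _)
      (mem_restrict_one.mpr ⟨(hloc ⟨U, x⟩).1, hlV⟩)
    have hUV : restrict 1 U V ⊆ V := fun t ht => (mem_restrict_one.mp ht).2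
    refine ⟨F.map (incl hUV) z, overVal_injective (Subtype.ext (Subtype.ext ?_))⟩
    show φ ⟨V, F.map (incl hUV) z⟩ = (overVal y).1.1
    have h2 := hφmul (incl (restrict_subset 1 U V)) z
    rw [hz, hx, mult_incl] at h2
    rw [h2, hφmul, mult_incl]
  · intro U V f
    ext x
    refine overVal_injective (Subtype.ext (Subtype.ext ?_))
    show φ ⟨V, F.map f x⟩ = (mult f : ℕ) • φ ⟨U, x⟩
    rw [hφmul, nsmul_eq_mul]

theorem exists_isOver_linear (p : ToposPoint HalfLineTopos) :
    ∃ (K : AddSubgroup ℚ) (c : ℝ≥0), K ≠ ⊥ ∧ IsOver p (PosMap.linear K c) :=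
  (isFlatContinuous_fiber p).exists_iso_linear

theorem exists_isOver (hH : IsRankOne H) (ℓ : PosMap H) : ∃ p, IsOver p ℓ :=
  exists_point_overFunctor hH ℓ

end Functors
end

section

/-! ### The semifields `ℤ_max` and `ℝ_max` -/

namespace MaxPlus

theorem of_injective {H : Type*} : Function.Injective (of : H → MaxPlus H) :=
  WithBot.coe_injective

section

variable {H : Type*} [AddCommGroup H] [LinearOrder H] [IsOrderedAddMonoid H]

set_option linter.unusedSectionVars false

theorem eq_zero_or_eq_of (x : MaxPlus H) : x = 0 ∨ ∃ h, x = of h := by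
  induction x using WithBot.recBotCoe with
  | bot => exact Or.inl rfl
  | coe h => exact Or.inr ⟨h, rfl⟩

theorem of_ne_zero (h : H) : of h ≠ 0 := WithBot.coe_ne_bot

theorem of_mul_of (a b : H) : of a * of b = of (a + b) := rfl

theorem of_add_of (a b : H) : of a + of b = of (max a b) := (WithBot.coe_max a b).symm

theorem one_eq_of : (1 : MaxPlus H) = of 0 := rfl

theorem of_pow (a : H) (n : ℕ) : of a ^ n = of (n • a) := by
  induction n with
  | zero => simp [one_eq_of]
  | succ n ih => rw [pow_succ, ih, of_mul_of, succ_nsmul]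

theorem frobenius_of (n : ℕ+) (a : H) : frobenius n (of a) = of ((n : ℕ) • a) := of_pow a n

theorem isUnit_of (a : H) : IsUnit (of a) :=
  IsUnit.of_mul_eq_one (of (-a)) (by rw [of_mul_of, add_neg_cancel]; rfl)

end

/-- The morphism `k ↦ k r` from `ℤ_max` to `ℝ_max`. -/
def scale (r : ℝ≥0) : MaxPlus ℤ →+* MaxPlus ℝ where
  toFun x := WithBot.map (fun k : ℤ => (k : ℝ) * r) x
  map_zero' := rfl
  map_one' := congr_arg of (by simp)
  map_mul' x y := by
    rcases eq_zero_or_eq_of x with rfl | ⟨a, rfl⟩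
    · rw [zero_mul]
      exact (zero_mul _).symm
    rcases eq_zero_or_eq_of y with rfl | ⟨b, rfl⟩
    · rw [mul_zero]
      exact (mul_zero _).symm
    rw [of_mul_of]
    refine Eq.trans (congr_arg of ?_) (of_mul_of ((a : ℝ) * r) ((b : ℝ) * r)).symm
    push_cast
    ring
  map_add' x y := by
    rcases eq_zero_or_eq_of x with rfl | ⟨a, rfl⟩
    · rw [zero_add]
      exact (zero_add _).symm
    rcases eq_zero_or_eq_of y with rfl | ⟨b, rfl⟩
    · rw [add_zero]
      exact (add_zero _).symm
    rw [of_add_of]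
    refine Eq.trans (congr_arg of ?_) (of_add_of ((a : ℝ) * r) ((b : ℝ) * r)).symm
    have hmono : Monotone fun k : ℤ => (k : ℝ) * r := fun a b hab =>
      mul_le_mul_of_nonneg_right (by exact_mod_cast hab) r.2
    exact hmono.map_max

theorem scale_of (r : ℝ≥0) (k : ℤ) : scale r (of k) = of ((k : ℝ) * r) := rfl

/-- A morphism from `ℤ_max` to `ℝ_max` is determined by the image of the generator. -/
theorem eq_scale (f : MaxPlus ℤ →+* MaxPlus ℝ) : ∃ r, f = scale r := by
  have hne : f (of 1) ≠ 0 := fun h => by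
    have h1 : f (of 1) * f (of (-1)) = 1 := by
      rw [← map_mul, of_mul_of, ← map_one f]
      rfl
    rw [h, zero_mul] at h1
    exact of_ne_zero 0 h1.symm
  obtain ⟨r, hr⟩ := (eq_zero_or_eq_of (f (of 1))).resolve_left hne
  have hr0 : 0 ≤ r := by
    -- The unit of `ℤ_max` is the integer `0`, so `max 1 0 = 1` gives `max r 0 = r` after applying
    -- `f`.
    have h1 : f (of 1) + f 1 = f (of 1) := by
      rw [← map_add]
      rfl
    rw [map_one, hr, one_eq_of, of_add_of] at h1
    exact max_eq_left_iff.mp (of_injective h1)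
  have hnat (n : ℕ) : f (of (n : ℤ)) = of ((n : ℝ) * r) := by
    have : of (n : ℤ) = of 1 ^ n := by rw [of_pow]; simp
    rw [this, map_pow, hr, of_pow, nsmul_eq_mul]
  lift r to ℝ≥0 using hr0
  refine ⟨r, RingHom.ext fun x => ?_⟩
  rcases eq_zero_or_eq_of x with rfl | ⟨k, rfl⟩
  · rw [map_zero, map_zero]
  rw [scale_of]
  obtain ⟨n, rfl | rfl⟩ := k.eq_nat_or_neg
  · exact_mod_cast hnat n
  · have h1 : f (of (-(n : ℤ))) * of ((n : ℝ) * r) = 1 := by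
      rw [← hnat, ← map_mul, of_mul_of, neg_add_cancel, ← map_one f]
      rfl
    calc f (of (-(n : ℤ))) = f (of (-(n : ℤ))) * (of ((n : ℝ) * r) * of (-((n : ℝ) * r))) := by
          rw [of_mul_of, add_neg_cancel, ← one_eq_of, mul_one]
      _ = of (-((n : ℝ) * r)) := by rw [← mul_assoc, h1, one_mul]
      _ = _ := congr_arg of (by push_cast; ring)

theorem scale_frobenius (r : ℝ≥0) (n : ℕ+) (k : MaxPlus ℤ) :
    scale r (frobenius n k) = scale (n * r) k := by
  rcases eq_zero_or_eq_of k with rfl | ⟨k, rfl⟩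
  · rw [map_zero, map_zero, map_zero]
  · rw [frobenius_of, scale_of, scale_of]
    congr 1
    push_cast
    rw [nsmul_eq_mul]
    push_cast
    ring

theorem frobenius_injective (n : ℕ+) : Function.Injective (frobenius (H := ℤ) n) := by
  intro x y h
  rcases eq_zero_or_eq_of x with rfl | ⟨a, rfl⟩ <;> rcases eq_zero_or_eq_of y with rfl | ⟨b, rfl⟩
  · rfl
  · rw [frobenius_of, map_zero] at h
    exact absurd h.symm (of_ne_zero _)
  · rw [frobenius_of, map_zero] at h
    exact absurd h (of_ne_zero _)
  · rw [frobenius_of, frobenius_of] at h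
    have h1 := of_injective h
    rw [nsmul_eq_mul, nsmul_eq_mul] at h1
    rw [mul_left_cancel₀ (by simp) h1]

end MaxPlus

/-! ### The stalks of the structure sheaf of the arithmetic site -/

section Germ

/-- The set with an action of `ℕ^×` associated with a point of the arithmetic site. -/
abbrev Carrier (p : ToposPoint ArithmeticTopos) : Type :=
  p.inverse.obj (yoneda.obj (SingleObj.star ℕ+))

/-- The action of `ℕ^×` on the set associated with a point. -/
def act {p : ToposPoint ArithmeticTopos} (n : ℕ+) (t : Carrier p) : Carrier p :=
  p.inverse.map (yoneda.map (X := SingleObj.star ℕ+) (Y := SingleObj.star ℕ+) n) t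

/-- The section of the structure sheaf given by an element of `ℤ_max`. -/
def sectionMap (k : MaxPlus ℤ) : yoneda.obj (SingleObj.star ℕ+) ⟶ underlying structureSheaf :=
  (yonedaEquiv (X := SingleObj.star ℕ+) (F := underlying structureSheaf)).symm k

/-- The element of `ℤ_max` that defines a section of the structure sheaf. -/
def sectionVal (f : yoneda.obj (SingleObj.star ℕ+) ⟶ underlying structureSheaf) : MaxPlus ℤ :=
  yonedaEquiv f

theorem sectionVal_sectionMap (k : MaxPlus ℤ) : sectionVal (sectionMap k) = k :=
  (yonedaEquiv (X := SingleObj.star ℕ+) (F := underlying structureSheaf)).apply_symm_apply k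

theorem sectionMap_eq {k : MaxPlus ℤ}
    {f : yoneda.obj (SingleObj.star ℕ+) ⟶ underlying structureSheaf} (h : k = sectionVal f) :
    sectionMap k = f :=
  (Equiv.symm_apply_eq _).mpr h

/-- The germ at `t` of an element of `ℤ_max`. -/
def germ {p : ToposPoint ArithmeticTopos} (k : MaxPlus ℤ) (t : Carrier p) :
    Stalk structureSheaf p :=
  Stalk.mk (sectionMap k) t

variable {p : ToposPoint ArithmeticTopos}

theorem germ_act (k : MaxPlus ℤ) (n : ℕ+) (t : Carrier p) :
    germ k (act n t) = germ (MaxPlus.frobenius n k) t := by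
  unfold germ act Stalk.mk
  have h : yoneda.map (X := SingleObj.star ℕ+) (Y := SingleObj.star ℕ+) n ≫ sectionMap k =
      sectionMap (MaxPlus.frobenius n k) :=
    map_yoneda_comp (P := underlying structureSheaf) (c := SingleObj.star ℕ+)
      (d := SingleObj.star ℕ+) n k
  rw [← Functor.map_comp_apply, h]

theorem exists_germ₂ (s s' : Stalk structureSheaf p) :
    ∃ (k k' : MaxPlus ℤ) (t : Carrier p), germ k t = s ∧ germ k' t = s' := by
  obtain ⟨c, k, k', t, h, h'⟩ := exists_span p.inverse (P := underlying structureSheaf)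
    (Q := underlying structureSheaf) s s'
  exact ⟨k, k', t, h, h'⟩

theorem exists_germ (s : Stalk structureSheaf p) :
    ∃ (k : MaxPlus ℤ) (t : Carrier p), germ k t = s := by
  obtain ⟨k, -, t, h, -⟩ := exists_germ₂ s s
  exact ⟨k, t, h⟩

/-- Sections with the same germ agree after the action of some `n`, which is by Frobenius and is
injective. -/
theorem germ_injective (t : Carrier p) : Function.Injective fun k => germ k t := by
  intro k k' h
  obtain ⟨e, n, z, -, hn⟩ := exists_equalizing p.inverse (P := underlying structureSheaf)
    (c := SingleObj.star ℕ+) k k' t h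
  exact MaxPlus.frobenius_injective n hn

/-- Preservation of products by the inverse image gives common divisors, and preservation of
equalizers gives uniqueness of multipliers. -/
theorem isFlatRelation_act (p : ToposPoint ArithmeticTopos) :
    IsFlatRelation fun (n : ℕ+) (z x : Carrier p) => act n z = x where
  nonempty := by
    obtain ⟨_, ⟨z⟩⟩ := exists_element p.inverse
    exact ⟨z⟩
  directed x y := by
    obtain ⟨e, m, n, z, h, h'⟩ := exists_span p.inverse x y
    refine ⟨z, m, n, ?_, ?_⟩
    · rw [← h, yonedaEquiv_symm_hom]
      rfl
    · rw [← h', yonedaEquiv_symm_hom]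
      rfl
  free := by
    intro m n z x hm hn
    obtain ⟨e, k, w, -, hk⟩ := exists_equalizing p.inverse
      (P := yoneda.obj (SingleObj.star ℕ+)) (c := SingleObj.star ℕ+) m n z (by
        rw [yonedaEquiv_symm_hom, yonedaEquiv_symm_hom]
        exact hm.trans hn.symm)
    have hk' : (m : ℕ+) * (k : ℕ+) = n * k := hk
    exact mul_right_cancel hk'
  comp := by
    rintro m n w _ _ rfl rfl
    unfold act
    rw [← Functor.map_comp_apply, ← Functor.map_comp]
    rfl
  exists_multiple n z := ⟨_, rfl⟩

/-- The morphism `k ↦ germ k t` from `ℤ_max` to the stalk. -/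
def germHom (t : Carrier p) : MaxPlus ℤ →+* Stalk structureSheaf p where
  toFun k := germ k t
  map_zero' := by
    rw [Stalk.zero_mk t]
    unfold germ
    rw [sectionMap_eq]
    rfl
  map_one' := by
    rw [Stalk.one_mk t]
    unfold germ
    rw [sectionMap_eq]
    rfl
  map_mul' k k' := by
    unfold germ
    rw [Stalk.mul_mk, sectionMap_eq]
    exact congr_arg₂ (fun a b : MaxPlus ℤ => a * b)
      (sectionVal_sectionMap k).symm (sectionVal_sectionMap k').symm
  map_add' k k' := by
    unfold germ
    rw [Stalk.add_mk, sectionMap_eq]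
    exact congr_arg₂ (fun a b : MaxPlus ℤ => a + b)
      (sectionVal_sectionMap k).symm (sectionVal_sectionMap k').symm

theorem germHom_apply (t : Carrier p) (k : MaxPlus ℤ) : germHom t k = germ k t := rfl

end Germ
end

section

/-! ### Points of the arithmetic site over `ℝ_max` -/

section ArithmeticPoints

variable {H H' : Type} [AddCommGroup H] [LinearOrder H] [IsOrderedAddMonoid H]
  [AddCommGroup H'] [LinearOrder H'] [IsOrderedAddMonoid H']

/-- The equivariant bijection given by an isomorphism of functors. -/
theorem exists_equiv_of_iso_positiveCone {p : ToposPoint ArithmeticTopos}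
    (e : yoneda ⋙ p.inverse ≅ positiveCone H) :
    ∃ a : Carrier p ≃ Pos H, (∀ n t, a (act n t) = n • a t) ∧
      ∀ t, a t = e.hom.app (SingleObj.star ℕ+) t := by
  refine ⟨(e.app (SingleObj.star ℕ+)).toEquiv, fun n t => ?_, fun t => rfl⟩
  exact NatTrans.naturality_apply e.hom (X := SingleObj.star ℕ+) (Y := SingleObj.star ℕ+) n t

theorem exists_iso_positiveCone_of_equiv {p : ToposPoint ArithmeticTopos}
    (a : Carrier p ≃ Pos H) (ha : ∀ n t, a (act n t) = n • a t) :
    ∃ e : yoneda ⋙ p.inverse ≅ positiveCone H,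
      ∀ t, a t = e.hom.app (SingleObj.star ℕ+) t := by
  refine ⟨NatIso.ofComponents (fun X => Equiv.toIso (X := (yoneda ⋙ p.inverse).obj X)
    (Y := (positiveCone H).obj X) a) ?_, fun t => rfl⟩
  intro X Y n
  ext t
  exact ha n t

/-- The set associated with the point `x` is isomorphic to `H_+`, in such a way that the morphism to
`ℝ_max` is given by `ℓ`. -/
def ArithmeticPoint.IsOver (x : ArithmeticPoint (MaxPlus ℝ)) (ℓ : PosMap H) : Prop :=
  ∃ a : Carrier x.point ≃ Pos H, (∀ n t, a (act n t) = n • a t) ∧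
    ∀ k t, x.hom (germ k t) = MaxPlus.scale (ℓ.toFun (a t)) k

namespace ArithmeticPoint

variable {x y : ArithmeticPoint (MaxPlus ℝ)} {ℓ : PosMap H} {ℓ' : PosMap H'}

/-- The germs at `t` form a copy of `ℤ_max`, on which the morphism is a scaling by some `r t`.
Passing from `t` to `n t` precomposes with Frobenius, that is, multiplies the scale by `n`. -/
theorem exists_length (x : ArithmeticPoint (MaxPlus ℝ)) :
    ∃ r : Carrier x.point → ℝ≥0, (∀ k t, x.hom (germ k t) = MaxPlus.scale (r t) k) ∧
      ∀ n t, r (act n t) = n * r t := by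
  choose r hr using fun t : Carrier x.point => MaxPlus.eq_scale (x.hom.comp (germHom t))
  have hr' (k t) : x.hom (germ k t) = MaxPlus.scale (r t) k := RingHom.congr_fun (hr t) k
  refine ⟨r, hr', fun n t => ?_⟩
  have h := hr' (MaxPlus.of 1) (act n t)
  rw [germ_act, hr', MaxPlus.scale_frobenius, MaxPlus.scale_of, MaxPlus.scale_of] at h
  have h1 := MaxPlus.of_injective h
  rw [Int.cast_one, one_mul, one_mul] at h1
  exact (NNReal.eq h1).symm

theorem exists_isOver_linear (x : ArithmeticPoint (MaxPlus ℝ)) :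
    ∃ (K : AddSubgroup ℚ) (c : ℝ≥0), K ≠ ⊥ ∧ x.IsOver (PosMap.linear K c) := by
  obtain ⟨φ, K, hK, hpos, hmul, hmem, hsurj, hinj⟩ := (isFlatRelation_act x.point).exists_degree
  let a : Carrier x.point ≃ Pos K := Equiv.ofBijective (fun t => ⟨⟨φ t, hmem t⟩, hpos t⟩)
    ⟨fun t t' h => by
      obtain ⟨z, m, rfl, rfl⟩ := hinj t t' (congr_arg (fun z : Pos K => (z.1 : ℚ)) h)
      rfl, fun k => by
      obtain ⟨t, ht⟩ := hsurj k.1.1 k.1.2 k.2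
      exact ⟨t, Subtype.ext (Subtype.ext ht)⟩⟩
  have ha (n t) : a (act n t) = n • a t := by
    refine Subtype.ext (Subtype.ext ?_)
    show φ (act n t) = (n : ℕ) • φ t
    rw [hmul n t _ rfl, nsmul_eq_mul]
  obtain ⟨r, hr, hrn⟩ := x.exists_length
  obtain ⟨c, hc⟩ := exists_linear hK (fun k => (r (a.symm k) : ℝ)) (fun n k => by
    have : a.symm (n • k) = act n (a.symm k) := by
      rw [Equiv.symm_apply_eq, ha, Equiv.apply_symm_apply]
    rw [this, hrn]
    simp)
  have hc0 : 0 ≤ c := by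
    obtain ⟨k⟩ := (isRankOne_of_ne_bot hK).isFlatRelation.nonempty
    have hk : (0 : ℝ) < (k.1.1 : ℝ) := by exact_mod_cast (show (0 : ℚ) < k.1.1 from k.2)
    have h1 : 0 ≤ c * (k.1.1 : ℝ) := by
      rw [← hc]
      exact (r (a.symm k)).2
    exact nonneg_of_mul_nonneg_left h1 hk
  lift c to ℝ≥0 using hc0
  refine ⟨K, c, hK, a, ha, fun k t => ?_⟩
  have : (PosMap.linear K c).toFun (a t) = r t := NNReal.eq (by
    rw [PosMap.linear_toFun, ← hc, a.symm_apply_apply])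
  rw [this, hr]

theorem IsOver.congr (hx : x.IsOver ℓ) (h : ℓ.IsIsoTo ℓ') : x.IsOver ℓ' := by
  obtain ⟨a, ha, hk⟩ := hx
  obtain ⟨e, he, hℓ⟩ := h
  refine ⟨a.trans e, fun n t => ?_, fun k t => ?_⟩
  · rw [Equiv.trans_apply, Equiv.trans_apply, ha, he]
  · rw [hk, Equiv.trans_apply, hℓ]

theorem IsOver.equiv_iff (hx : x.IsOver ℓ) (hy : y.IsOver ℓ') : x ≈ y ↔ ℓ.IsIsoTo ℓ' := by
  obtain ⟨a, ha, hka⟩ := hx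
  obtain ⟨b, hb, hkb⟩ := hy
  constructor
  · rintro ⟨E, hE⟩
    let d : Carrier x.point ≃ Carrier y.point := (E.app (yoneda.obj (SingleObj.star ℕ+))).toEquiv
    have hd (n t) : d (act n t) = act n (d t) := NatTrans.naturality_apply E.hom _ t
    refine ⟨(a.symm.trans d).trans b, fun n h => ?_, fun h => ?_⟩
    · have : a.symm (n • h) = act n (a.symm h) := by
        rw [Equiv.symm_apply_eq, ha, Equiv.apply_symm_apply]
      simp only [Equiv.trans_apply]
      rw [this, hd, hb]
    · obtain ⟨t, rfl⟩ := a.surjective h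
      simp only [Equiv.trans_apply, Equiv.symm_apply_apply]
      -- The germ of the generator of `ℤ` detects the scale.
      have h1 := hE (germ (MaxPlus.of 1) t)
      have h2 : E.hom.app (underlying structureSheaf) (germ (MaxPlus.of 1) t) =
          germ (MaxPlus.of 1) (d t) := NatTrans.naturality_apply E.hom _ t
      rw [h2] at h1
      have h3 := (hkb _ _).symm.trans (h1.trans (hka _ _))
      rw [MaxPlus.scale_of, MaxPlus.scale_of] at h3
      have h4 := MaxPlus.of_injective h3
      rw [Int.cast_one, one_mul, one_mul] at h4
      exact NNReal.eq h4
  · rintro ⟨e, he, hℓ⟩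
    obtain ⟨f, hf⟩ := exists_iso_positiveCone_of_equiv (a.trans e) (fun n t => by
      rw [Equiv.trans_apply, Equiv.trans_apply, ha, he])
    obtain ⟨g, hg⟩ := exists_iso_positiveCone_of_equiv b hb
    -- An isomorphism of the associated `ℕ^×`-sets extends to the points. Compatibility with the
    -- morphisms to `ℝ_max` need only be checked on germs.
    obtain ⟨E, hE⟩ := exists_iso_of_iso_representables (f ≪≫ g.symm)
    refine ⟨E, fun s => ?_⟩
    obtain ⟨k, t, rfl⟩ := exists_germ (p := x.point) s
    let t' : Carrier y.point := E.hom.app (yoneda.obj (SingleObj.star ℕ+)) t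
    have h2 : E.hom.app (underlying structureSheaf) (germ k t) = germ k t' :=
      NatTrans.naturality_apply E.hom _ t
    have h3 : b t' = e (a t) := by
      rw [hg]
      simp only [t', hE]
      rw [← Equiv.trans_apply, hf]
      exact g.inv_hom_id_app_apply _ _
    rw [h2, hka]
    refine (hkb k t').trans ?_
    rw [h3, hℓ]

theorem IsOver.isIsoTo (hx : x.IsOver ℓ) (hx' : x.IsOver ℓ') : ℓ.IsIsoTo ℓ' :=
  (hx.equiv_iff hx').mp (Setoid.refl x)

/-- The morphism from the stalk to `ℝ_max` defined by an equivariant map. -/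
theorem exists_hom {p : ToposPoint ArithmeticTopos} (r : Carrier p → ℝ≥0)
    (hr : ∀ n t, r (act n t) = n * r t) :
    ∃ f : Stalk structureSheaf p →+* MaxPlus ℝ, ∀ k t, f (germ k t) = MaxPlus.scale (r t) k := by
  choose k t hkt using fun s : Stalk structureSheaf p => exists_germ s
  -- The value does not depend on how an element of the stalk is written as a germ: two expressions
  -- are compared at a common divisor of `t` and `t'`, where germs are injective.
  have hcongr {k k' : MaxPlus ℤ} {t t' : Carrier p} (h : germ k t = germ k' t') :
      MaxPlus.scale (r t) k = MaxPlus.scale (r t') k' := by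
    obtain ⟨w, m, n, rfl, rfl⟩ := (isFlatRelation_act p).directed t t'
    rw [germ_act, germ_act] at h
    rw [hr, hr, ← MaxPlus.scale_frobenius, ← MaxPlus.scale_frobenius, germ_injective w h]
  have key (k' : MaxPlus ℤ) (t' : Carrier p) :
      MaxPlus.scale (r (t (germ k' t'))) (k (germ k' t')) = MaxPlus.scale (r t') k' :=
    hcongr (hkt _)
  refine ⟨{ toFun := fun s => MaxPlus.scale (r (t s)) (k s)
            map_one' := ?_, map_zero' := ?_, map_mul' := ?_, map_add' := ?_ }, key⟩
  · have := key 1 (t 1)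
    rwa [← germHom_apply, map_one, map_one] at this
  · intro s s'
    obtain ⟨a, b, w, rfl, rfl⟩ := exists_germ₂ s s'
    have : germ a w * germ b w = germ (a * b) w := (map_mul (germHom w) a b).symm
    rw [this, key, key, key, map_mul]
  · have := key 0 (t 0)
    rwa [← germHom_apply, map_zero, map_zero] at this
  · intro s s'
    obtain ⟨a, b, w, rfl, rfl⟩ := exists_germ₂ s s'
    have : germ a w + germ b w = germ (a + b) w := (map_add (germHom w) a b).symm
    rw [this, key, key, key, map_add]

theorem exists_isOver (hH : IsRankOne H) (ℓ : PosMap H) :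
    ∃ x : ArithmeticPoint (MaxPlus ℝ), x.IsOver ℓ := by
  have : IsCofiltered (positiveCone H).Elements :=
    { nonempty := by
        obtain ⟨h⟩ := hH.isFlatRelation.nonempty
        exact ⟨⟨SingleObj.star ℕ+, h⟩⟩
      cone_objs := by
        rintro ⟨X, h⟩ ⟨Y, h'⟩
        obtain ⟨z, m, n, hm, hn⟩ := hH.exists_common (h : Pos H) (h' : Pos H)
        exact ⟨⟨SingleObj.star ℕ+, z⟩, ⟨(m : ℕ+), hm⟩, ⟨(n : ℕ+), hn⟩, trivial⟩
      cone_maps := by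
        rintro ⟨X, h⟩ ⟨Y, h'⟩ ⟨f, hf⟩ ⟨g, hg⟩
        have h' : f = g := Pos.smul_left_injective (h : Pos H) (hf.trans hg.symm)
        subst h'
        exact ⟨_, 𝟙 _, rfl⟩ }
  have : InitiallySmall.{0} (positiveCone H).Elements := initiallySmall_of_essentiallySmall _
  -- For the trivial topology, with only maximal sieves covering, a flat functor is a point of the
  -- site.
  let Φ : GrothendieckTopology.Point.{0} (⊥ : GrothendieckTopology (SingleObj ℕ+)) :=
    { fiber := positiveCone H
      jointly_surjective := fun {X} R hR h => by
        obtain rfl : R = ⊤ := by simpa using hR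
        exact ⟨X, 𝟙 X, trivial, h, by simp⟩ }
  let p : ToposPoint ArithmeticTopos :=
    ⟨Φ.presheafFiber, Φ.skyscraperPresheafFunctor, Φ.skyscraperPresheafAdjunction, inferInstance⟩
  let e : yoneda ⋙ p.inverse ≅ positiveCone H :=
    Functor.isoWhiskerRight shrinkYonedaIsoYoneda.symm _ ≪≫ Φ.shrinkYonedaCompPresheafFiberIso
  obtain ⟨a, ha, -⟩ := exists_equiv_of_iso_positiveCone e
  obtain ⟨f, hf⟩ := exists_hom (fun t => ℓ.toFun (a t)) (fun n t => by rw [ha, ℓ.map_smul])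
  refine ⟨⟨p, f, ⟨fun s hs => ?_⟩⟩, a, ha, hf⟩
  -- Locality costs nothing: a germ is zero or invertible, and zero goes to `-∞`, which is not a
  -- unit.
  obtain ⟨k, t, rfl⟩ := exists_germ s
  rcases MaxPlus.eq_zero_or_eq_of k with rfl | ⟨k, rfl⟩
  · rw [hf, map_zero] at hs
    exact absurd (isUnit_zero_iff.mp hs).symm (MaxPlus.of_ne_zero 0)
  · rw [← germHom_apply]
    exact (MaxPlus.isUnit_of k).map (germHom t)

theorem IsOver.range_eq {K : AddSubgroup ℚ} {c : ℝ≥0} (hK : K ≠ ⊥)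
    (hx : x.IsOver (PosMap.linear K c)) :
    Set.range x.hom = insert 0 (MaxPlus.of '' (scaledSubgroup c K : Set ℝ)) := by
  obtain ⟨a, ha, hk⟩ := hx
  have hof (k : ℤ) (t) : x.hom (germ (MaxPlus.of k) t) =
      MaxPlus.of (c * ((k * (a t).1.1 : ℚ) : ℝ)) := by
    rw [hk, MaxPlus.scale_of, PosMap.linear_toFun]
    push_cast
    congr 1
    ring
  ext s
  constructor
  · rintro ⟨s, rfl⟩
    obtain ⟨k, t, rfl⟩ := exists_germ s
    rcases MaxPlus.eq_zero_or_eq_of k with rfl | ⟨k, rfl⟩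
    · rw [hk, map_zero]
      exact Set.mem_insert _ _
    · rw [hof]
      refine Set.mem_insert_of_mem _ ⟨_, ⟨_, ?_, rfl⟩, rfl⟩
      have := K.zsmul_mem (a t).1.2 k
      rwa [zsmul_eq_mul] at this
  · rintro (rfl | ⟨_, ⟨q, hq, rfl⟩, rfl⟩)
    · exact ⟨0, map_zero _⟩
    · show MaxPlus.of ((c : ℝ) * (q : ℝ)) ∈ _
      -- The elements `t` give only positive `q`; the other elements of `K` are reached with the
      -- germs of `-1` and `0`.
      rcases lt_trichotomy q 0 with h0 | rfl | h0
      · obtain ⟨t, ht⟩ := a.surjective ⟨⟨-q, neg_mem hq⟩, neg_pos.mpr h0⟩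
        refine ⟨germ (MaxPlus.of (-1)) t, ?_⟩
        rw [hof, ht]
        congr 1
        push_cast
        ring
      · obtain ⟨h⟩ := (isRankOne_of_ne_bot hK).isFlatRelation.nonempty
        obtain ⟨t, ht⟩ := a.surjective h
        refine ⟨germ (MaxPlus.of 0) t, ?_⟩
        rw [hof]
        simp
      · obtain ⟨t, ht⟩ := a.surjective ⟨⟨q, hq⟩, h0⟩
        refine ⟨germ (MaxPlus.of 1) t, ?_⟩
        rw [hof, ht]
        congr 1
        push_cast
        ring

theorem IsOver.isOfSubgroup_iff_eq {K : AddSubgroup ℚ} {c : ℝ≥0} (hK : K ≠ ⊥)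
    (hx : x.IsOver (PosMap.linear K c)) {H : AddSubgroup ℝ} :
    x.IsOfSubgroup H ↔ H = scaledSubgroup c K := by
  unfold IsOfSubgroup
  rw [hx.range_eq hK]
  constructor
  · intro h
    ext r
    have h1 : MaxPlus.of r ∈ insert 0 (MaxPlus.of '' (scaledSubgroup c K : Set ℝ)) ↔
        MaxPlus.of r ∈ insert 0 (MaxPlus.of '' (H : Set ℝ)) := by rw [h]
    simpa only [Set.mem_insert_iff, MaxPlus.of_ne_zero, false_or,
      MaxPlus.of_injective.mem_set_image, SetLike.mem_coe] using h1.symm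
  · rintro rfl
    rfl

/-- In the normal form `(K, c)` the image is `(c K)_max`. Rank one excludes `c = 0`, where `c K` is
trivial, and for `c ≠ 0` the map is isomorphic to the inclusion of `c K`. -/
theorem isOfSubgroup_iff {H : AddSubgroup ℝ} (hH : IsRankOne H) :
    x.IsOfSubgroup H ↔ x.IsOver (PosMap.ofSubgroup H) := by
  obtain ⟨K, c, hK, hx⟩ := x.exists_isOver_linear
  rw [hx.isOfSubgroup_iff_eq hK]
  constructor
  · rintro rfl
    refine hx.congr (PosMap.linear_isIsoTo_ofSubgroup ?_)
    rintro rfl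
    obtain ⟨⟨r, hr⟩, hr0⟩ := hH.exists_ne_zero
    obtain ⟨k, -, rfl⟩ := mem_scaledSubgroup.mp hr
    exact hr0 (Subtype.ext (by simp))
  · intro hx'
    have hc : c ≠ 0 := by
      rintro rfl
      rw [PosMap.linear_zero] at hx
      exact PosMap.not_ofSubgroup_isIsoTo_zero hH (hx'.isIsoTo hx)
    exact PosMap.eq_of_ofSubgroup_isIsoTo
      (hx'.isIsoTo (hx.congr (PosMap.linear_isIsoTo_ofSubgroup hc)))

theorem isOfOrderedGroup_iff : x.IsOfOrderedGroup H ↔ x.IsOver (PosMap.zero H) := by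
  constructor
  · rintro ⟨⟨e⟩, h⟩
    obtain ⟨a, ha, -⟩ := exists_equiv_of_iso_positiveCone e
    obtain ⟨r, hr, -⟩ := x.exists_length
    refine ⟨a, ha, fun k t => ?_⟩
    have h1 := hr (MaxPlus.of 1) t
    rw [MaxPlus.scale_of] at h1
    -- The germ of the generator goes to the real number `r t`, not to `-∞`, so it must go to the
    -- unit, and `r t = 0`.
    have h2 := (h (germ (MaxPlus.of 1) t)).resolve_left (by
      rw [h1]
      exact MaxPlus.of_ne_zero _)
    rw [h1, Int.cast_one, one_mul] at h2
    have h3 : r t = 0 := NNReal.eq (MaxPlus.of_injective h2)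
    rw [hr, h3]
    rfl
  · rintro ⟨a, ha, hk⟩
    obtain ⟨e, -⟩ := exists_iso_positiveCone_of_equiv a ha
    refine ⟨⟨e⟩, fun s => ?_⟩
    obtain ⟨k, t, rfl⟩ := exists_germ s
    rw [hk]
    rcases MaxPlus.eq_zero_or_eq_of k with rfl | ⟨k, rfl⟩
    · exact Or.inl (map_zero _)
    · refine Or.inr ?_
      rw [MaxPlus.scale_of]
      exact congr_arg MaxPlus.of (mul_zero _)

end ArithmeticPoint
end ArithmeticPoints
end

section

open IsDedekindDomain HeightOneSpectrum

/-! ### The valuations of a rational number -/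

/-- Because `ℤ` is principal, each place has a generator, and products of powers of generators
realize any finitely supported family of exponents. -/
theorem exists_valuation_eq (f : HeightOneSpectrum ℤ →₀ ℤ) :
    ∃ q : ℚ, 0 < q ∧ ∀ v : HeightOneSpectrum ℤ, v.valuation ℚ q = WithZero.exp (f v) := by
  induction f using Finsupp.induction_linear with
  | zero => exact ⟨1, one_pos, fun v => by simp⟩
  | add f g hf hg =>
    obtain ⟨q, hq, hqv⟩ := hf
    obtain ⟨r, hr, hrv⟩ := hg
    exact ⟨q * r, mul_pos hq hr, fun v => by
      rw [map_mul, hqv, hrv, Finsupp.add_apply, WithZero.exp_add]⟩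
  | single w n =>
    obtain ⟨g, hg⟩ := (IsPrincipalIdealRing.principal w.asIdeal).principal
    replace hg : w.asIdeal = Ideal.span {g} := hg
    have hg0 : g ≠ 0 := fun h => w.ne_bot (by rw [hg, h, Ideal.span_singleton_eq_bot])
    have habs : ∀ v : HeightOneSpectrum ℤ, v.valuation ℚ |(g : ℚ)| = v.intValuation g := by
      intro v
      have hgv : v.valuation ℚ (g : ℚ) = v.intValuation g := v.valuation_of_algebraMap (K := ℚ) g
      rcases abs_choice (g : ℚ) with h | h <;> rw [h]
      · exact hgv
      · rw [Valuation.map_neg, hgv]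
    -- A generator has multiplicative valuation `exp (-1)` at its own place, hence the exponent
    -- `-n`; the absolute value makes the number positive.
    refine ⟨|(g : ℚ)| ^ (-n), zpow_pos (abs_pos.2 (Int.cast_ne_zero.2 hg0)) _, fun v => ?_⟩
    rw [map_zpow₀, habs]
    by_cases hv : v = w
    · subst hv
      rw [v.intValuation_singleton hg0 hg, Finsupp.single_eq_same, ← WithZero.exp_zsmul]
      simp
    · have h1 : v.intValuation g = 1 := by
        rw [intValuation_eq_one_iff]
        intro hgv
        have hle : w.asIdeal ≤ v.asIdeal := by
          rw [hg, Ideal.span_singleton_le_iff_mem]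
          exact hgv
        exact hv (HeightOneSpectrum.ext (w.isMaximal.eq_of_le v.isPrime.ne_top hle).symm)
      rw [h1, one_zpow, Finsupp.single_eq_of_ne hv, WithZero.exp_zero]

/-- A rational number belongs to a subgroup as soon as it does so locally. -/
theorem mem_of_forall_valuation_le {K : AddSubgroup ℚ} {q : ℚ}
    (h : ∀ v : HeightOneSpectrum ℤ, ∃ k ∈ K, v.valuation ℚ q ≤ v.valuation ℚ k) : q ∈ K := by
  -- This is the ideal of integers that multiply `q` into `K`; the local conditions show that no
  -- maximal ideal contains it.
  let I : Ideal ℤ :=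
    { carrier := {n | (n : ℚ) * q ∈ K}
      zero_mem' := by simp [K.zero_mem]
      add_mem' := fun {m n} hm hn => by
        change ((m + n : ℤ) : ℚ) * q ∈ K
        rw [Int.cast_add, add_mul]
        exact K.add_mem hm hn
      smul_mem' := fun m n hn => by
        change ((m • n : ℤ) : ℚ) * q ∈ K
        rw [smul_eq_mul, Int.cast_mul, mul_assoc, ← zsmul_eq_mul]
        exact K.zsmul_mem hn m }
  suffices hI : I = ⊤ by
    have h1 : (1 : ℤ) ∈ I := hI ▸ Submodule.mem_top
    have h2 : ((1 : ℤ) : ℚ) * q ∈ K := h1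
    rwa [Int.cast_one, one_mul] at h2
  by_contra hI
  obtain ⟨M, hM, hIM⟩ := Ideal.exists_le_maximal I hI
  have hM0 : M ≠ ⊥ := Ring.ne_bot_of_isMaximal_of_not_isField hM Int.not_isField
  let v : HeightOneSpectrum ℤ := ⟨M, hM.isPrime, hM0⟩
  obtain ⟨k, hk, hqk⟩ := h v
  -- As `q / k` is integral at `v`, it has a denominator `d` outside `M`, and `d q = n k` lies in
  -- `K`.
  obtain ⟨n, d, hnd⟩ := v.exists_primeCompl_mul_eq_of_integer (K := ℚ) (q / k) (by
    rw [map_div₀]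
    exact div_le_one_of_le₀ hqk zero_le)
  apply d.2
  apply hIM
  change ((d : ℤ) : ℚ) * q ∈ K
  rcases eq_or_ne k 0 with rfl | hk0
  · rw [map_zero, le_zero_iff, Valuation.zero_iff] at hqk
    rw [hqk, mul_zero]
    exact K.zero_mem
  · have h1 : ((d : ℤ) : ℚ) * q = n * k := by
      rw [eq_intCast, eq_intCast] at hnd
      rw [← hnd]
      field_simp
    rw [h1, ← zsmul_eq_mul]
    exact K.zsmul_mem hk n

/-! ### Finite adeles and subgroups of `ℚ` -/

theorem mem_zhat_iff {a : FiniteAdele} : a ∈ zhat ↔ ∀ v, Valued.v (a v) ≤ 1 :=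
  Iff.rfl

theorem FiniteAdele.mul_apply (a b : FiniteAdele) (v : HeightOneSpectrum ℤ) :
    (a * b) v = a v * b v :=
  rfl

theorem valued_algebraMap_mul (q : ℚ) (a : FiniteAdele) (v : HeightOneSpectrum ℤ) :
    Valued.v ((algebraMap ℚ FiniteAdele q * a) v) = v.valuation ℚ q * Valued.v (a v) := by
  rw [FiniteAdele.mul_apply, map_mul, FiniteAdeleRing.algebraMap_apply,
    valuedAdicCompletion_eq_valuation']

theorem mem_finiteAdeleGroup_iff {a : FiniteAdele} {q : ℚ} :
    q ∈ finiteAdeleGroup a ↔ ∀ v, v.valuation ℚ q * Valued.v (a v) ≤ 1 := by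
  refine Iff.trans (mem_zhat_iff (a := algebraMap ℚ FiniteAdele q * a)) ?_
  simp_rw [valued_algebraMap_mul]

theorem valued_unit (u : zhatˣ) (v : HeightOneSpectrum ℤ) :
    Valued.v (((u : zhat) : FiniteAdele) v) = 1 := by
  have h : (((u : zhat) : FiniteAdele) v) * (((u⁻¹ : zhatˣ) : zhat) : FiniteAdele) v = 1 := by
    rw [← FiniteAdele.mul_apply, ← Subring.coe_mul, Units.mul_inv]
    rfl
  refine le_antisymm ((u : zhat).2 v) ?_
  rw [← map_one (Valued.v (R := v.adicCompletion ℚ)), ← h, map_mul]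
  exact mul_le_of_le_one_right' (((u⁻¹ : zhatˣ) : zhat).2 v)

/-- A rational number with prescribed valuation at one place, the valuations of which at the other
places are bounded by those of a finite adele. -/
theorem exists_valuation_mul_le_one (a : FiniteAdele) (w : HeightOneSpectrum ℤ) (n : ℤ) :
    ∃ q : ℚ, 0 < q ∧ w.valuation ℚ q = WithZero.exp n ∧
      ∀ v ≠ w, v.valuation ℚ q * Valued.v (a v) ≤ 1 := by
  classical
  -- Away from `w`, the exponent cancels the valuation of `a` at the finitely many places where `a`
  -- is not integral, and vanishes elsewhere.
  let f : HeightOneSpectrum ℤ → ℤ := fun v =>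
    if v = w then n else if Valued.v (a v) ≤ 1 then 0 else -WithZero.log (Valued.v (a v))
  have hf : f.support.Finite := by
    have ha : {v | ¬ Valued.v (a v) ≤ 1}.Finite := a.2
    refine (ha.insert w).subset fun v hv => ?_
    by_contra h
    rw [Set.mem_insert_iff, not_or, Set.mem_ofPred_eq, not_not] at h
    exact hv (by simp only [f, if_neg h.1, if_pos h.2])
  obtain ⟨q, hq, hqv⟩ := exists_valuation_eq (Finsupp.ofSupportFinite f hf)
  have hqf : ∀ v, v.valuation ℚ q = WithZero.exp (f v) := hqv
  refine ⟨q, hq, by rw [hqf]; simp only [f, if_pos], fun v hv => ?_⟩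
  rw [hqf]
  by_cases h : Valued.v (a v) ≤ 1
  · simp only [f, if_neg hv, if_pos h]
    rwa [WithZero.exp_zero, one_mul]
  · simp only [f, if_neg hv, if_neg h]
    have h0 : Valued.v (a v) ≠ 0 := fun h' => h (h' ▸ zero_le)
    rw [WithZero.exp_neg, WithZero.exp_log h0, inv_mul_cancel₀ h0]

theorem finiteAdeleGroup_ne_bot (a : FiniteAdele) : finiteAdeleGroup a ≠ ⊥ := by
  obtain ⟨M, hM⟩ := Ideal.exists_maximal ℤ
  let w : HeightOneSpectrum ℤ :=
    ⟨M, hM.isPrime, Ring.ne_bot_of_isMaximal_of_not_isField hM Int.not_isField⟩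
  -- The place `w` is arbitrary. If `a` vanishes there, the logarithm has its default value `0`,
  -- which is harmless since the condition at `w` then holds trivially.
  obtain ⟨q, hq, hqw, hqv⟩ :=
    exists_valuation_mul_le_one a w (-WithZero.log (Valued.v (a w)))
  intro h
  have hmem : q ∈ finiteAdeleGroup a := by
    rw [mem_finiteAdeleGroup_iff]
    intro v
    by_cases hv : v = w
    · rw [hv, hqw]
      by_cases h0 : Valued.v (a w) = 0
      · rw [h0, mul_zero]
        exact zero_le
      · rw [WithZero.exp_neg, WithZero.exp_log h0, inv_mul_cancel₀ h0]
    · exact hqv v hv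
  rw [h, AddSubgroup.mem_bot] at hmem
  exact hq.ne' hmem

/-- Were the valuation of `b` larger at `w`, a rational could be chosen that makes `b` barely
non-integral at `w` and `a` integral everywhere. Discreteness of the valuation makes this possible.
Applied both ways, `H_a` determines all valuations of `a`. -/
theorem valued_le_of_finiteAdeleGroup_le {a b : FiniteAdele}
    (h : finiteAdeleGroup a ≤ finiteAdeleGroup b) (w : HeightOneSpectrum ℤ) :
    Valued.v (b w) ≤ Valued.v (a w) := by
  by_contra! hlt
  have hb : Valued.v (b w) ≠ 0 := (zero_le.trans_lt hlt).ne'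
  obtain ⟨q, -, hqw, hqv⟩ :=
    -- The exponent gives `q b` the valuation `exp 1` at `w`, the smallest one above `1`; the
    -- strictly smaller valuation of `q a` is then at most `1`.
    exists_valuation_mul_le_one a w (1 - WithZero.log (Valued.v (b w)))
  have hqb : w.valuation ℚ q * Valued.v (b w) = WithZero.exp 1 := by
    rw [hqw, WithZero.exp_sub, WithZero.exp_log hb, div_mul_cancel₀ _ hb]
  have hmem : q ∈ finiteAdeleGroup a := by
    rw [mem_finiteAdeleGroup_iff]
    intro v
    by_cases hv : v = w
    · subst hv
      have hlt' : v.valuation ℚ q * Valued.v (a v) < WithZero.exp 1 := by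
        rw [← hqb]
        refine mul_lt_mul_of_pos_left hlt ?_
        rw [hqw]
        exact WithZero.exp_pos
      by_contra! h1
      have hne : v.valuation ℚ q * Valued.v (a v) ≠ 0 := (zero_lt_one.trans h1).ne'
      rw [← WithZero.exp_log hne] at h1 hlt'
      rw [← WithZero.exp_zero, WithZero.exp_lt_exp] at h1
      rw [WithZero.exp_lt_exp] at hlt'
      omega
    · exact hqv v hv
  have h1 := mem_finiteAdeleGroup_iff.1 (h hmem) w
  rw [hqb, ← WithZero.exp_zero, WithZero.exp_le_exp] at h1
  omega

/-- The unit is `b / a` at the places where `a ≠ 0`, and `1` where `a`, hence `b`, vanishes; the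
inverse is built symmetrically. -/
theorem exists_eq_mul_zhat_unit {a b : FiniteAdele}
    (h : ∀ v, Valued.v (a v) = Valued.v (b v)) :
    ∃ u : zhatˣ, b = a * ((u : zhat) : FiniteAdele) := by
  classical
  have key : ∀ c d : FiniteAdele, (∀ v, Valued.v (c v) = Valued.v (d v)) →
      ∀ v, Valued.v (if c v = 0 then 1 else d v / c v) ≤ 1 := by
    intro c d hcd v
    by_cases h0 : c v = 0
    · rw [if_pos h0, map_one]
    · rw [if_neg h0, map_div₀, hcd v]
      exact div_self_le_one _
  let r : (c d : FiniteAdele) → (∀ v, Valued.v (c v) = Valued.v (d v)) → zhat := fun c d hcd =>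
    ⟨⟨fun v => if c v = 0 then 1 else d v / c v, Filter.Eventually.of_forall (key c d hcd)⟩,
      key c d hcd⟩
  have hr : ∀ c d hcd v, (r c d hcd : FiniteAdele) v = if c v = 0 then 1 else d v / c v :=
    fun _ _ _ _ => rfl
  have h0 : ∀ c d : FiniteAdele, (∀ v, Valued.v (c v) = Valued.v (d v)) → ∀ v, c v = 0 → d v = 0 :=
    fun c d hcd v hv => by
      rw [← Valuation.zero_iff (Valued.v (R := v.adicCompletion ℚ)), ← hcd, hv, map_zero]
  have hmul : ∀ c d hcd hdc, r c d hcd * r d c hdc = 1 := by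
    intro c d hcd hdc
    apply Subtype.ext
    apply FiniteAdeleRing.ext
    intro v
    rw [Subring.coe_mul, FiniteAdele.mul_apply, hr c d hcd, hr d c hdc]
    change _ = (1 : v.adicCompletion ℚ)
    by_cases hc : c v = 0
    · rw [if_pos hc, if_pos (h0 c d hcd v hc), mul_one]
    · have hd : d v ≠ 0 := fun hd => hc (h0 d c hdc v hd)
      rw [if_neg hc, if_neg hd, div_mul_div_comm, mul_comm, div_self (mul_ne_zero hc hd)]
  have h' : ∀ v, Valued.v (b v) = Valued.v (a v) := fun v => (h v).symm
  refine ⟨⟨r a b h, r b a h', hmul _ _ h h', hmul _ _ h' h⟩, FiniteAdeleRing.ext _ fun v => ?_⟩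
  change b v = a v * ((r a b h : FiniteAdele) v)
  rw [hr a b h]
  by_cases ha : a v = 0
  · rw [ha, zero_mul, h0 a b h v ha]
  · rw [if_neg ha, mul_div_cancel₀ _ ha]

/-- Every nonzero subgroup of `ℚ` is the group of a finite adele. -/
theorem exists_finiteAdeleGroup_eq {K : AddSubgroup ℚ} (hK : K ≠ ⊥) :
    ∃ a : FiniteAdele, finiteAdeleGroup a = K := by
  classical
  obtain ⟨x, hxK, hx0⟩ := K.bot_or_exists_ne_zero.resolve_left hK
  -- At `v`, the component is the inverse of an element of `K` of largest valuation, or `0` if there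
  -- is none. The first condition keeps it integral wherever `x` has valuation at least `1`, which
  -- is almost everywhere.
  have hloc : ∀ v : HeightOneSpectrum ℤ, ∃ y : v.adicCompletion ℚ,
      (1 ≤ v.valuation ℚ x → Valued.v y ≤ 1) ∧
      ∀ q : ℚ, v.valuation ℚ q * Valued.v y ≤ 1 ↔ ∃ k ∈ K, v.valuation ℚ q ≤ v.valuation ℚ k := by
    intro v
    by_cases hmax : ∃ k₀ ∈ K, ∀ k ∈ K, v.valuation ℚ k ≤ v.valuation ℚ k₀
    · obtain ⟨k₀, hk₀, hle⟩ := hmax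
      have hpos : 0 < v.valuation ℚ k₀ :=
        (Valuation.pos_iff _).2 hx0 |>.trans_le (hle x hxK)
      refine ⟨algebraMap ℚ FiniteAdele k₀⁻¹ v, fun h1 => ?_, fun q => ?_⟩
      · rw [FiniteAdeleRing.algebraMap_apply, valuedAdicCompletion_eq_valuation', map_inv₀]
        exact inv_le_one_of_one_le₀ (h1.trans (hle x hxK))
      · rw [FiniteAdeleRing.algebraMap_apply, valuedAdicCompletion_eq_valuation', map_inv₀, ← div_eq_mul_inv, div_le_one₀ hpos]
        exact ⟨fun h => ⟨k₀, hk₀, h⟩, fun ⟨k, hk, h⟩ => h.trans (hle k hk)⟩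
    · refine ⟨0, fun _ => by rw [map_zero]; exact zero_le, fun q => ?_⟩
      rw [map_zero, mul_zero]
      refine ⟨fun _ => ?_, fun _ => zero_le⟩
      by_contra! hlt
      apply hmax
      have hq0 : v.valuation ℚ q ≠ 0 := (zero_le.trans_lt (hlt x hxK)).ne'
      -- If `q` were not dominated, the valuations on `K` would be bounded, and a bounded set of
      -- integer exponents has a greatest element.
      obtain ⟨n, ⟨k₀, hk₀, hk₀0, rfl⟩, hn⟩ := Int.exists_greatest_of_bdd
        (P := fun n => ∃ k ∈ K, k ≠ 0 ∧ WithZero.log (v.valuation ℚ k) = n)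
        ⟨WithZero.log (v.valuation ℚ q), fun n ⟨k, hk, hk0, hn⟩ => by
          rw [← hn, WithZero.log_le_log ((Valuation.ne_zero_iff _).2 hk0) hq0]
          exact (hlt k hk).le⟩ ⟨_, x, hxK, hx0, rfl⟩
      refine ⟨k₀, hk₀, fun k hk => ?_⟩
      rcases eq_or_ne k 0 with rfl | hk0
      · rw [map_zero]
        exact zero_le
      · rw [← WithZero.log_le_log ((Valuation.ne_zero_iff _).2 hk0)
          ((Valuation.ne_zero_iff _).2 hk₀0)]
        exact hn _ ⟨k, hk, hk0, rfl⟩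
  choose y hy1 hy2 using hloc
  have hfin : ∀ᶠ v in Filter.cofinite, y v ∈ v.adicCompletionIntegers ℚ := by
    refine (HeightOneSpectrum.Support.finite ℤ (x⁻¹ : ℚ)).subset fun v hv => ?_
    change 1 < v.valuation ℚ x⁻¹
    by_contra h
    apply hv
    apply hy1
    rw [not_lt, map_inv₀] at h
    exact (inv_le_one₀ ((Valuation.pos_iff _).2 hx0)).1 h
  let a : FiniteAdele := ⟨y, hfin⟩
  refine ⟨a, ?_⟩
  ext q
  rw [mem_finiteAdeleGroup_iff]
  refine (forall_congr' fun v => hy2 v q).trans ⟨mem_of_forall_valuation_le, fun hq v => ?_⟩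
  exact ⟨q, hq, le_rfl⟩

/-! ### The archimedean place -/

theorem norm_extensionEmbedding {v : NumberField.InfinitePlace ℚ} (hv : v.IsReal)
    (x : v.Completion) :
    ‖NumberField.InfinitePlace.Completion.extensionEmbeddingOfIsReal hv x‖ = ‖x‖ :=
  (AddMonoidHomClass.isometry_iff_norm _).1
    (NumberField.InfinitePlace.Completion.isometry_extensionEmbeddingOfIsReal hv) x

/-- The completion embeds isometrically in `ℝ`, where the norm determines a number up to sign. -/
theorem eq_or_eq_neg_of_norm_eq {x y : Rat.infinitePlace.Completion} (h : ‖x‖ = ‖y‖) :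
    x = y ∨ x = -y := by
  have hinj := (NumberField.InfinitePlace.Completion.extensionEmbeddingOfIsReal
    Rat.isReal_infinitePlace).injective
  rw [← norm_extensionEmbedding Rat.isReal_infinitePlace,
    ← norm_extensionEmbedding Rat.isReal_infinitePlace, Real.norm_eq_abs, Real.norm_eq_abs,
    abs_eq_abs, ← map_neg] at h
  exact h.imp (fun h => hinj h) (fun h => hinj h)

theorem exists_norm_eq (v : NumberField.InfinitePlace ℚ) (c : ℝ≥0) :
    ∃ x : v.Completion, ‖x‖ = c := by
  have hv : v.IsReal := Subsingleton.elim Rat.infinitePlace v ▸ Rat.isReal_infinitePlace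
  obtain ⟨x, hx⟩ :=
    NumberField.InfinitePlace.Completion.surjective_extensionEmbeddingOfIsReal hv (c : ℝ)
  refine ⟨x, ?_⟩
  rw [← norm_extensionEmbedding hv, hx, Real.norm_of_nonneg c.coe_nonneg]

/-! ### The adele class space -/

/-- The absolute value of the archimedean component, as a nonnegative real number. -/
def archimedeanNNAbs (a : Adele) : ℝ≥0 :=
  ‖a.1 Rat.infinitePlace‖₊

theorem coe_archimedeanNNAbs (a : Adele) : (archimedeanNNAbs a : ℝ) = archimedeanAbs a :=
  rfl

theorem archimedeanAbs_algebraMap_mul (q : ℚ) (a : Adele) :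
    archimedeanAbs (algebraMap ℚ Adele q * a) = |(q : ℝ)| * archimedeanAbs a := by
  have h : (algebraMap ℚ Adele q * a).1 Rat.infinitePlace =
      (algebraMap ℚ Rat.infinitePlace.Completion q) * a.1 Rat.infinitePlace := rfl
  unfold archimedeanAbs
  rw [h, norm_mul, eq_ratCast, NumberField.InfinitePlace.Completion.Rat.norm_infinitePlace_completion,
    Rat.cast_abs]

theorem archimedeanAbs_mul_zhatUnit (a : Adele) (u : zhatˣ) :
    archimedeanAbs (a * zhatUnit u) = archimedeanAbs a := by
  have h : (a * zhatUnit u).1 Rat.infinitePlace = a.1 Rat.infinitePlace * 1 := rfl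
  unfold archimedeanAbs
  rw [h, mul_one]

/-- The map `k ↦ |a_∞| k` on the positive part of `H_a`. -/
def adeleMap (a : Adele) : PosMap (finiteAdeleGroup a.2) :=
  PosMap.linear (finiteAdeleGroup a.2) (archimedeanNNAbs a)

theorem mem_finiteAdeleGroup_abs_mul {a : FiniteAdele} {q k : ℚ} :
    |q| * k ∈ finiteAdeleGroup a ↔ q * k ∈ finiteAdeleGroup a := by
  rcases abs_choice q with h | h <;> rw [h]
  rw [neg_mul, neg_mem_iff]

theorem mem_finiteAdeleGroup_algebraMap_mul {a : FiniteAdele} {q k : ℚ} :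
    k ∈ finiteAdeleGroup (algebraMap ℚ FiniteAdele q * a) ↔ q * k ∈ finiteAdeleGroup a := by
  simp_rw [mem_finiteAdeleGroup_iff, valued_algebraMap_mul, map_mul]
  exact forall_congr' fun v => by rw [← mul_assoc, mul_comm (v.valuation ℚ k)]

/-- A scaling by `q` from `H_a` to `H_b` matches the valuations of `a` with those of `q b`, so the
finite parts differ by a unit of `Ẑ`, while the archimedean parts agree up to sign. -/
theorem adeleMap_isIsoTo_iff {a b : Adele} : (adeleMap a).IsIsoTo (adeleMap b) ↔ a ≈ b := by
  rw [adeleMap, adeleMap, PosMap.linear_isIsoTo_iff (finiteAdeleGroup_ne_bot _)]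
  simp_rw [coe_archimedeanNNAbs]
  constructor
  · rintro ⟨q, hq, hqK, habs⟩
    apply Setoid.symm
    have hq' : |(q : ℝ)| = q := abs_of_pos (Rat.cast_pos.2 hq)
    have hnorm : archimedeanAbs a = archimedeanAbs (algebraMap ℚ Adele q * b) := by
      rw [archimedeanAbs_algebraMap_mul, hq', habs, mul_comm]
    have hgroup : finiteAdeleGroup a.2 = finiteAdeleGroup (algebraMap ℚ FiniteAdele q * b.2) := by
      ext k
      rw [hqK, mem_finiteAdeleGroup_algebraMap_mul]
    obtain ⟨u, hu⟩ := exists_eq_mul_zhat_unit (a := algebraMap ℚ FiniteAdele q * b.2) (b := a.2)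
      fun v => le_antisymm (valued_le_of_finiteAdeleGroup_le hgroup.le v)
        (valued_le_of_finiteAdeleGroup_le hgroup.ge v)
    have hfst : ∀ x y : NumberField.InfiniteAdeleRing ℚ,
        x Rat.infinitePlace = y Rat.infinitePlace → x = y := fun x y h =>
      funext fun v => by
        obtain rfl : Rat.infinitePlace = v := Subsingleton.elim _ _
        exact h
    rcases eq_or_eq_neg_of_norm_eq hnorm with h | h
    · refine ⟨Units.mk0 q hq.ne', u, Prod.ext (hfst _ _ ?_) hu⟩
      refine h.trans ?_
      exact (mul_one _).symm
    -- When the archimedean signs differ, `-q` corrects them, and `-u` undoes the effect on the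
    -- finite part.
    · refine ⟨Units.mk0 (-q) (neg_ne_zero.2 hq.ne'), -u, Prod.ext (hfst _ _ ?_) ?_⟩
      · refine h.trans ?_
        change -(algebraMap ℚ Rat.infinitePlace.Completion q * b.1 Rat.infinitePlace) =
          algebraMap ℚ Rat.infinitePlace.Completion (-q) * b.1 Rat.infinitePlace * 1
        rw [map_neg, mul_one, neg_mul]
      · refine hu.trans ?_
        change algebraMap ℚ FiniteAdele q * b.2 * ((u : zhat) : FiniteAdele) =
          algebraMap ℚ FiniteAdele (-q) * b.2 * -((u : zhat) : FiniteAdele)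
        rw [map_neg, neg_mul, neg_mul_neg]
  · intro h
    obtain ⟨q, u, h⟩ := Setoid.symm h
    refine ⟨|(q : ℚ)|, abs_pos.2 q.ne_zero, fun k => ?_, ?_⟩
    · rw [mem_finiteAdeleGroup_abs_mul, ← mem_finiteAdeleGroup_algebraMap_mul]
      have h2 : a.2 = algebraMap ℚ FiniteAdele q * b.2 * ((u : zhat) : FiniteAdele) :=
        congr_arg Prod.snd h
      rw [mem_finiteAdeleGroup_iff, mem_finiteAdeleGroup_iff, h2]
      exact forall_congr' fun v => by
        rw [FiniteAdele.mul_apply, map_mul, valued_unit, mul_one]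
    · rw [h, archimedeanAbs_mul_zhatUnit, archimedeanAbs_algebraMap_mul, mul_comm, Rat.cast_abs]

theorem exists_adeleMap_isIsoTo {K : AddSubgroup ℚ} (hK : K ≠ ⊥) (c : ℝ≥0) :
    ∃ a : Adele, (adeleMap a).IsIsoTo (PosMap.linear K c) := by
  obtain ⟨b, rfl⟩ := exists_finiteAdeleGroup_eq hK
  choose x hx using fun v => exists_norm_eq v c
  let a : Adele := ((show NumberField.InfiniteAdeleRing ℚ from x), b)
  refine ⟨a, (PosMap.linear_isIsoTo_iff (finiteAdeleGroup_ne_bot _)).2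
    ⟨1, one_pos, fun k => by rw [one_mul], ?_⟩⟩
  rw [Rat.cast_one, mul_one]
  exact hx _

end

/-! ### Bijections between isomorphism classes and the trichotomy of supports -/

section

/-- A total relation compatible with two equivalence relations identifies their quotients. -/
theorem exists_quotient_equiv {A B : Type*} [sA : Setoid A] [sB : Setoid B] (r : A → B → Prop)
    (hA : ∀ a, ∃ b, r a b) (hB : ∀ b, ∃ a, r a b)
    (hr : ∀ a a' b b', r a b → r a' b' → (a ≈ a' ↔ b ≈ b')) :
    ∃ E : Quotient sA ≃ Quotient sB, ∀ a b, E ⟦a⟧ = ⟦b⟧ → ∃ b', b' ≈ b ∧ r a b' := by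
  choose f hf using hA
  let F : Quotient sA → Quotient sB :=
    Quotient.map f fun a a' h => (hr a a' _ _ (hf a) (hf a')).1 h
  have hF : Function.Bijective F := by
    constructor
    · rintro ⟨a⟩ ⟨a'⟩ h
      exact Quotient.sound ((hr a a' _ _ (hf a) (hf a')).2 (Quotient.exact h))
    · rintro ⟨b⟩
      obtain ⟨a, hab⟩ := hB b
      exact ⟨⟦a⟧, Quotient.sound ((hr a a _ _ (hf a) hab).1 (Setoid.refl a))⟩
  exact ⟨Equiv.ofBijective F hF, fun a b h => ⟨f a, Quotient.exact h, hf a⟩⟩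

/-- The map `k ↦ |a_∞| k` describes the point associated with an adele `a`. -/
theorem exists_equiv_adeleClass :
    ∃ Ψ : AdeleClass ≃ ArithmeticPoint.IsoClass (MaxPlus ℝ),
      ∀ (a : Adele) (x : ArithmeticPoint (MaxPlus ℝ)), Ψ ⟦a⟧ = ⟦x⟧ → x.IsOver (adeleMap a) := by
  obtain ⟨Ψ, hΨ⟩ := exists_quotient_equiv
    (fun (a : Adele) (x : ArithmeticPoint (MaxPlus ℝ)) => x.IsOver (adeleMap a))
    (fun a => ArithmeticPoint.exists_isOver (isRankOne_of_ne_bot (finiteAdeleGroup_ne_bot a.2)) _)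
    (fun x => by
      obtain ⟨K, c, hK, hx⟩ := x.exists_isOver_linear
      obtain ⟨a, ha⟩ := exists_adeleMap_isIsoTo hK c
      exact ⟨a, hx.congr ha.symm⟩)
    (fun a b x y hx hy => adeleMap_isIsoTo_iff.symm.trans (hx.equiv_iff hy).symm)
  refine ⟨Ψ, fun a x h => ?_⟩
  -- The correspondence holds for some `y` isomorphic to `x`; it passes to `x` by comparing normal
  -- forms.
  obtain ⟨y, hyx, hy⟩ := hΨ a x h
  obtain ⟨K, c, -, hx⟩ := x.exists_isOver_linear
  exact hx.congr ((hy.equiv_iff hx).1 hyx).symm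

/-- A point of the arithmetic site and a point of the half-line correspond to each other when they
are described by the same equivariant map. -/
theorem exists_equiv_points :
    ∃ Θ : ArithmeticPoint.IsoClass (MaxPlus ℝ) ≃ ToposPoint.IsoClass HalfLineTopos,
      ∀ (x : ArithmeticPoint (MaxPlus ℝ)) (p : ToposPoint HalfLineTopos), Θ ⟦x⟧ = ⟦p⟧ →
        ∃ (K : AddSubgroup ℚ) (c : ℝ≥0),
          x.IsOver (PosMap.linear K c) ∧ IsOver p (PosMap.linear K c) := by
  obtain ⟨Θ, hΘ⟩ := exists_quotient_equiv
    (fun (x : ArithmeticPoint (MaxPlus ℝ)) (p : ToposPoint HalfLineTopos) =>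
      ∃ (K : AddSubgroup ℚ) (c : ℝ≥0),
        x.IsOver (PosMap.linear K c) ∧ IsOver p (PosMap.linear K c))
    (fun x => by
      obtain ⟨K, c, hK, hx⟩ := x.exists_isOver_linear
      obtain ⟨p, hp⟩ := exists_isOver (isRankOne_of_ne_bot hK) (PosMap.linear K c)
      exact ⟨p, K, c, hx, hp⟩)
    (fun p => by
      obtain ⟨K, c, hK, hp⟩ := exists_isOver_linear p
      obtain ⟨x, hx⟩ :=
        ArithmeticPoint.exists_isOver (isRankOne_of_ne_bot hK) (PosMap.linear K c)
      exact ⟨x, K, c, hx, hp⟩)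
    (fun x y p q ⟨K, c, hx, hp⟩ ⟨K', c', hy, hq⟩ => (hx.equiv_iff hy).trans (hp.equiv_iff hq).symm)
  refine ⟨Θ, fun x p h => ?_⟩
  obtain ⟨q, hqp, K, c, hx, hq⟩ := hΘ x p h
  obtain ⟨K', c', -, hp⟩ := exists_isOver_linear p
  exact ⟨K, c, hx, hp.congr ((hq.equiv_iff hp).1 hqp).symm⟩

theorem IsOver.support_eq_singleton {p : ToposPoint HalfLineTopos} {H : Type} [AddCommGroup H]
    [LinearOrder H] [IsOrderedAddMonoid H] (hH : IsRankOne H) (hp : IsOver p (PosMap.zero H)) :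
    support p = {0} := by
  rw [hp.support_eq]
  obtain ⟨x⟩ := hH.isFlatRelation.nonempty
  ext l
  exact ⟨fun ⟨_, h⟩ => h.symm, fun h => ⟨x, Eq.symm h⟩⟩

theorem IsOver.zero_notMem_support {p : ToposPoint HalfLineTopos} {H : AddSubgroup ℝ}
    (hp : IsOver p (PosMap.ofSubgroup H)) : 0 ∉ support p := by
  rw [hp.support_eq]
  rintro ⟨x, hx⟩
  exact (PosMap.ofSubgroup_pos x).ne' hx

/-- The two cases are `c ≠ 0` and `c = 0` in the normal form `(K, c)`. -/
theorem exists_isOfSubgroup_or_isOfOrderedGroup (p : ToposPoint HalfLineTopos) :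
    (∃ H : AddSubgroup ℝ, IsRankOne H ∧ IsOfSubgroup p H) ∨
      ∃ K : AddSubgroup ℚ, IsRankOne K ∧ IsOfOrderedGroup p K := by
  obtain ⟨K, c, hK, hp⟩ := exists_isOver_linear p
  rcases eq_or_ne c 0 with rfl | hc
  · rw [PosMap.linear_zero] at hp
    exact Or.inr ⟨K, isRankOne_of_ne_bot hK, isOfOrderedGroup_iff.2 hp⟩
  · exact Or.inl ⟨scaledSubgroup c K, isRankOne_scaledSubgroup (NNReal.coe_ne_zero.2 hc) hK,
      isOfSubgroup_iff.2 (hp.congr (PosMap.linear_isIsoTo_ofSubgroup hc))⟩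

end

end ScalingTopos

end

theorem theorem3 :
    -- the canonical bijection from `A(ℝ_max)` to the points of `[0,∞) ⋊ ℕ^×`
    (∃ Θ : ArithmeticPoint.IsoClass (MaxPlus ℝ) ≃ ToposPoint.IsoClass HalfLineTopos,
      ∀ (x : ArithmeticPoint (MaxPlus ℝ)) (p : ToposPoint HalfLineTopos), Θ ⟦x⟧ = ⟦p⟧ →
        (∀ H : AddSubgroup ℝ, IsRankOne H →
          (x.IsOfSubgroup H ↔ IsOfSubgroup p H)) ∧
        (∀ (H : Type) [AddCommGroup H] [LinearOrder H] [IsOrderedAddMonoid H], IsRankOne H →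
          (x.IsOfOrderedGroup H ↔ IsOfOrderedGroup p H))) ∧
    -- the canonical bijection from `ℚ^× \ 𝔸 / Ẑ^*` to `A(ℝ_max)`
    (∃ Ψ : AdeleClass ≃ ArithmeticPoint.IsoClass (MaxPlus ℝ),
      ∀ (a : Adele) (x : ArithmeticPoint (MaxPlus ℝ)), Ψ ⟦a⟧ = ⟦x⟧ →
        (archimedeanAbs a ≠ 0 → x.IsOfSubgroup (adeleSubgroup a)) ∧
        (archimedeanAbs a = 0 → x.IsOfOrderedGroup (finiteAdeleGroup a.2))) ∧
    -- the support of a point either does not contain `0`, or is reduced to `0`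
    (∀ p : ToposPoint HalfLineTopos, 0 ∉ support p ∨ support p = {0}) ∧
    -- the points with `0` outside of the support, up to isomorphism, are the rank one subgroups
    (∀ p : ToposPoint HalfLineTopos, 0 ∉ support p ↔
      ∃ H : AddSubgroup ℝ, IsRankOne H ∧ IsOfSubgroup p H) ∧
    (∀ H : AddSubgroup ℝ, IsRankOne H → ∃ p : ToposPoint HalfLineTopos, IsOfSubgroup p H) ∧
    (∀ (H H' : AddSubgroup ℝ) (p p' : ToposPoint HalfLineTopos), IsRankOne H → IsRankOne H' →
      IsOfSubgroup p H → IsOfSubgroup p' H' →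
        ((⟦p⟧ : ToposPoint.IsoClass HalfLineTopos) = ⟦p'⟧ ↔ H = H')) ∧
    -- the points concentrated at `0`, up to isomorphism, are the abstract rank one ordered groups,
    -- up to isomorphism
    (∀ p : ToposPoint HalfLineTopos, support p = {0} ↔
      ∃ (H : Type) (_ : AddCommGroup H) (_ : LinearOrder H) (_ : IsOrderedAddMonoid H),
        IsRankOne H ∧ IsOfOrderedGroup p H) ∧
    (∀ (H : Type) [AddCommGroup H] [LinearOrder H] [IsOrderedAddMonoid H], IsRankOne H →
      ∃ p : ToposPoint HalfLineTopos, IsOfOrderedGroup p H) ∧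
    (∀ (H H' : Type) [AddCommGroup H] [LinearOrder H] [IsOrderedAddMonoid H]
      [AddCommGroup H'] [LinearOrder H'] [IsOrderedAddMonoid H']
      (p p' : ToposPoint HalfLineTopos), IsRankOne H → IsRankOne H' →
      IsOfOrderedGroup p H → IsOfOrderedGroup p' H' →
        ((⟦p⟧ : ToposPoint.IsoClass HalfLineTopos) = ⟦p'⟧ ↔ Nonempty (H ≃+o H'))) := by
  have hcases := exists_isOfSubgroup_or_isOfOrderedGroup
  have hzero : ∀ (H : Type) [AddCommGroup H] [LinearOrder H] [IsOrderedAddMonoid H],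
      IsRankOne H → ∀ p : ToposPoint HalfLineTopos, IsOfOrderedGroup p H → support p = {0} :=
    fun _ _ _ _ hH _ hp => (isOfOrderedGroup_iff.1 hp).support_eq_singleton hH
  have hpos : ∀ (H : AddSubgroup ℝ) (p : ToposPoint HalfLineTopos), IsOfSubgroup p H →
      0 ∉ support p :=
    fun _ _ hp => (isOfSubgroup_iff.1 hp).zero_notMem_support
  refine ⟨?_, ?_, fun p => ?_, fun p => ⟨fun h => ?_, fun ⟨H, _, h⟩ => hpos H p h⟩,
    fun H hH => ?_, fun H H' p p' _ _ hp hp' => ?_, fun p => ⟨fun h => ?_, ?_⟩,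
    fun H _ _ _ hH => ?_, fun H H' _ _ _ _ _ _ p p' hH hH' hp hp' => ?_⟩
  · obtain ⟨Θ, hΘ⟩ := exists_equiv_points
    refine ⟨Θ, fun x p h => ?_⟩
    obtain ⟨K, c, hx, hp⟩ := hΘ x p h
    refine ⟨fun H hH => ?_, fun H _ _ _ _ => ?_⟩
    · rw [ArithmeticPoint.isOfSubgroup_iff hH, isOfSubgroup_iff]
      exact ⟨fun hx' => hp.congr (hx.isIsoTo hx'), fun hp' => hx.congr (hp.isIsoTo hp')⟩
    · rw [ArithmeticPoint.isOfOrderedGroup_iff, isOfOrderedGroup_iff]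
      exact ⟨fun hx' => hp.congr (hx.isIsoTo hx'), fun hp' => hx.congr (hp.isIsoTo hp')⟩
  · obtain ⟨Ψ, hΨ⟩ := exists_equiv_adeleClass
    refine ⟨Ψ, fun a x h => ⟨fun _ => ?_, fun h0 => ?_⟩⟩
    · exact ((hΨ a x h).isOfSubgroup_iff_eq (finiteAdeleGroup_ne_bot a.2)).2 rfl
    · have hx := hΨ a x h
      have hc : archimedeanNNAbs a = 0 := NNReal.eq h0
      rw [adeleMap, hc, PosMap.linear_zero] at hx
      exact ArithmeticPoint.isOfOrderedGroup_iff.2 hx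
  · rcases hcases p with ⟨H, _, h⟩ | ⟨K, hK, h⟩
    · exact Or.inl (hpos H p h)
    · exact Or.inr (hzero K hK p h)
  · rcases hcases p with hp | ⟨K, hK, hp⟩
    · exact hp
    · exact absurd (hzero K hK p hp ▸ Set.mem_singleton (0 : ℝ≥0)) h
  · obtain ⟨p, hp⟩ := exists_isOver hH (PosMap.ofSubgroup H)
    exact ⟨p, isOfSubgroup_iff.2 hp⟩
  · rw [Quotient.eq]
    constructor
    · intro h
      exact PosMap.eq_of_ofSubgroup_isIsoTo
        (((isOfSubgroup_iff.1 hp).equiv_iff (isOfSubgroup_iff.1 hp')).1 h)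
    · rintro rfl
      exact ((isOfSubgroup_iff.1 hp).equiv_iff (isOfSubgroup_iff.1 hp')).2
        ((isOfSubgroup_iff.1 hp).isIsoTo (isOfSubgroup_iff.1 hp))
  · rcases hcases p with ⟨H, _, hp⟩ | ⟨K, hK, hp⟩
    · exact absurd (h ▸ Set.mem_singleton (0 : ℝ≥0)) (hpos H p hp)
    · exact ⟨K, inferInstance, inferInstance, inferInstance, hK, hp⟩
  · rintro ⟨H, _, _, _, hH, hp⟩
    exact hzero H hH p hp
  · obtain ⟨p, hp⟩ := exists_isOver hH (PosMap.zero H)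
    exact ⟨p, isOfOrderedGroup_iff.2 hp⟩
  · rw [Quotient.eq]
    refine ((isOfOrderedGroup_iff.1 hp).equiv_iff (isOfOrderedGroup_iff.1 hp')).trans
      ⟨fun h => PosIso.nonempty_orderAddIso hH hH' h.posIso, fun ⟨f⟩ => ?_⟩
    exact PosMap.zero_isIsoTo_zero (posIso_of_orderAddIso f)
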